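/- Let $\mathbb T$ be the set of isomorphism classes of finite rooted trees. For $t\in\mathbb T$ let $V(t)$ and $E(t)$ be its sets of vertices and edges, $|t|=|V(t)|$, and let $\xi_t$ be the number of graph automorphisms of $t$ that fix the root. For $e\in E(t)$, removing $e$ divides $t$ into two rooted trees; let $R_e(t)$ be the one containing the root of $t$ and $P_e(t)$ the other one, rooted at its vertex nearest to the root of $t$. For $s,t\in\mathbb T$ and $v\in V(s)$ let $s\cup_v t$ be the rooted tree, with the root of $s$, obtained by joining the root of $t$ to $v$ by a new edge. Put $$\alpha(t_1,t_2,t_3)=|\{e\in E(t_2)\mid R_e(t_2)=t_3,\ P_e(t_2)=t_1\}|,\qquad \beta(t_1,t_2,t_3)=|\{v\in V(t_3)\mid t_1=t_3\cup_v t_2\}|.$$ The insertion-elimination algebra $\mathfrak g$ is the Lie algebra over $\mathbb C$ with basis $\{d\}\cup\{D_t^+,D_t^-\mid t\in\mathbb T\}$ and brackets, for $s,t\in\mathbb T$, $$[D_s^+,D_t^+]=\sum_{r\in\mathbb T}(\beta(r,s,t)-\beta(r,t,s))D_r^+,\qquad [D_s^-,D_t^-]=\sum_{r\in\mathbb T}(\alpha(t,r,s)-\alpha(s,r,t))D_r^-,$$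 $$[D_s^-,D_t^+]=\sum_{r\in\mathbb T}\alpha(s,t,r)D_r^++\sum_{r\in\mathbb T}\beta(s,t,r)D_r^-\quad(s\ne t),\qquad [D_t^-,D_t^+]=d,$$ $$[d,D_t^-]=-|t|D_t^-,\qquad [d,D_t^+]=|t|D_t^+.$$ For $\zeta\in\mathbb C^*$ let $\tau_\zeta:\mathfrak g\to\mathfrak g$ be the linear map with $\tau_\zeta(d)=d$, $\tau_\zeta(D_t^+)=\zeta^{|t|}D_t^+$ and $\tau_\zeta(D_t^-)=\zeta^{-|t|}D_t^-$ for all $t\in\mathbb T$. Let $\sigma:\mathfrak g\to\mathfrak g$ be the linear map with $\sigma(d)=d$, $\sigma(D_t^+)=\xi_tD_t^-$ and $\sigma(D_t^-)=\xi_t^{-1}D_t^+$ for all $t\in\mathbb T$, let $S(x)=-x$, and put $\tau_0=\sigma\circ S$. Theorem. The maps $\tau_\zeta$ ($\zeta\in\mathbb C^*$) and $\tau_0$ are automorphisms of the Lie algebra $\mathfrak g$; the sets $\mathcal A_{\mathbb C^*}=\{\tau_\zeta\mid\zeta\in\mathbb C^*\}$ and $\mathcal A_0=\{\mathrm{id}_{\mathfrak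 g},\tau_0\}$ are subgroups of the group $\mathrm{Aut}_{\mathbb C}(\mathfrak g)$ of all Lie algebra automorphisms of $\mathfrak g$; and $\mathrm{Aut}_{\mathbb C}(\mathfrak g)$ is the internal semidirect product $$\mathrm{Aut}_{\mathbb C}(\mathfrak g)=\mathcal A_{\mathbb C^*}\rtimes\mathcal A_0,$$ that is, $\mathcal A_{\mathbb C^*}$ is normal and every automorphism is uniquely a product of an element of $\mathcal A_{\mathbb C^*}$ and an element of $\mathcal A_0$. Moreover $\tau_0\circ\tau_\zeta\circ\tau_0=\tau_{\zeta^{-1}}$ for all $\zeta\in\mathbb C^*$. -/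

import Mathlib

/-- Finite rooted trees: a root together with a finite family of children, each of which is the
root of a rooted tree. Two such trees are identified below when they are isomorphic as rooted
graphs, so the order in which the children are listed plays no role. -/
inductive RTree : Type
  | node (n : ℕ) (c : Fin n → RTree) : RTree

namespace RTree

/-- The vertices of a rooted tree: the root, and the vertices of the components. -/
inductive Vert : RTree → Type
  | root {n : ℕ} {c : Fin n → RTree} : Vert (node n c)
  | child {n : ℕ} {c : Fin n → RTree} (i : Fin n) (v : Vert (c i)) : Vert (node n c)

/-- The edges of a rooted tree: for each component, the edge joining the root to the root of that
component, and the edges of the component. -/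
inductive Edge : RTree → Type
  | top {n : ℕ} {c : Fin n → RTree} (i : Fin n) : Edge (node n c)
  | child {n : ℕ} {c : Fin n → RTree} (i : Fin n) (e : Edge (c i)) : Edge (node n c)

/-- The root of `t`, as a vertex of `t`. -/
def rt : (t : RTree) → Vert t
  | node _ _ => Vert.root

/-- The endpoint of an edge that is nearer to the root. -/
def upper : {t : RTree} → Edge t → Vert t
  | _, Edge.top _ => Vert.root
  | _, Edge.child i e => Vert.child i (upper e)

/-- The endpoint of an edge that is farther from the root. -/
def lower : {t : RTree} → Edge t → Vert t
  | _, Edge.top i => Vert.child i (rt _)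
  | _, Edge.child i e => Vert.child i (lower e)

/-- The undirected graph underlying a rooted tree. -/
def graph (t : RTree) : SimpleGraph (Vert t) :=
  SimpleGraph.fromEdgeSet (Set.range fun e : Edge t => s(upper e, lower e))

/-- Isomorphism of rooted trees: a graph isomorphism that maps the root to the root. -/
def IsIso (s t : RTree) : Prop :=
  ∃ f : graph s ≃g graph t, f (rt s) = rt t

/-- `graft s v t` is the tree `s ∪_v t`: the root of `t` is joined to the vertex `v` of `s` by a
new edge, and the root of the result is that of `s`. -/
def graft : (s : RTree) → Vert s → RTree → RTree
  | node n c, Vert.root, t => node (n + 1) (Fin.cons t c)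
  | node n c, Vert.child i v, t => node n (Function.update c i (graft (c i) v t))

/-- The rooted tree with components `c j`, `j ≠ i`. -/
def eraseChild : {n : ℕ} → (Fin n → RTree) → Fin n → RTree
  | 0, _, i => i.elim0
  | n + 1, c, i => node n fun j => c (i.succAbove j)

/-- `P_e(t)`: the part of `t` not containing the root of `t`, after removal of the edge `e`. -/
def pruned : (t : RTree) → Edge t → RTree
  | node _ c, Edge.top i => c i
  | node _ c, Edge.child i e => pruned (c i) e

/-- `R_e(t)`: the part of `t` containing the root of `t`, after removal of the edge `e`. -/
def trunk : (t : RTree) → Edge t → RTree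
  | node _ c, Edge.top i => eraseChild c i
  | node n c, Edge.child i e => node n (Function.update c i (trunk (c i) e))

theorem IsIso.refl (t : RTree) : IsIso t t := ⟨SimpleGraph.Iso.refl, rfl⟩

theorem IsIso.symm {s t : RTree} (h : IsIso s t) : IsIso t s := by
  obtain ⟨f, hf⟩ := h
  exact ⟨f.symm, by rw [← hf]; exact f.symm_apply_apply _⟩

theorem IsIso.trans {s t u : RTree} (h : IsIso s t) (h' : IsIso t u) : IsIso s u := by
  obtain ⟨f, hf⟩ := h
  obtain ⟨g, hg⟩ := h'
  exact ⟨f.trans g, by rw [← hg, ← hf]; rfl⟩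

instance setoid : Setoid RTree where
  r := IsIso
  iseqv := ⟨IsIso.refl, IsIso.symm, IsIso.trans⟩

/-- The number of graph automorphisms of `t` fixing the root. -/
noncomputable def numAut (t : RTree) : ℕ :=
  Nat.card {f : graph t ≃g graph t // f (rt t) = rt t}

end RTree

/-- The set `𝕋` of isomorphism classes of rooted trees. -/
def TreeClass : Type := Quotient RTree.setoid

namespace TreeClass

/-- The isomorphism class of a rooted tree. -/
def mk (t : RTree) : TreeClass := Quotient.mk _ t

/-- A representative of an isomorphism class. -/
noncomputable def rep (t : TreeClass) : RTree := Quotient.out t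

/-- The number `|t|` of vertices. -/
noncomputable def size (t : TreeClass) : ℕ := Nat.card (RTree.Vert t.rep)

/-- The number `ξ_t = |Γ_t|` of symmetries of `t`. -/
noncomputable def xi (t : TreeClass) : ℕ := RTree.numAut t.rep

/-- `α(t₁, t₂, t₃)`: the number of edges `e` of `t₂` with `R_e(t₂) = t₃` and `P_e(t₂) = t₁`. -/
noncomputable def alpha (t₁ t₂ t₃ : TreeClass) : ℕ :=
  Nat.card {e : RTree.Edge t₂.rep // mk (RTree.trunk t₂.rep e) = t₃ ∧
    mk (RTree.pruned t₂.rep e) = t₁}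

/-- `β(t₁, t₂, t₃)`: the number of vertices `v` of `t₃` with `t₁ = t₃ ∪_v t₂`. -/
noncomputable def beta (t₁ t₂ t₃ : TreeClass) : ℕ :=
  Nat.card {v : RTree.Vert t₃.rep // t₁ = mk (RTree.graft t₃.rep v t₂.rep)}

end TreeClass

/-- Labels of the standard basis of the insertion-elimination algebra. -/
inductive InsElimGen : Type
  | d : InsElimGen
  | plus (t : TreeClass) : InsElimGen
  | minus (t : TreeClass) : InsElimGen

/-- The insertion-elimination algebra `𝔤`, as the complex vector space with basis
`{d} ∪ {D_t⁺, D_t⁻ ∣ t ∈ 𝕋}`. -/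
def InsElim : Type := InsElimGen →₀ ℂ

namespace InsElim

noncomputable instance : AddCommGroup InsElim := inferInstanceAs (AddCommGroup (InsElimGen →₀ ℂ))

noncomputable instance : Module ℂ InsElim := inferInstanceAs (Module ℂ (InsElimGen →₀ ℂ))

/-- The standard basis of the insertion-elimination algebra. -/
noncomputable def stdBasis : Module.Basis InsElimGen ℂ InsElim :=
  Module.Basis.ofRepr (LinearEquiv.refl ℂ (InsElimGen →₀ ℂ))

/-- The basis element `d`. -/
noncomputable def d : InsElim := stdBasis InsElimGen.d

/-- The basis element `D_t⁺`. -/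
noncomputable def Dp (t : TreeClass) : InsElim := stdBasis (InsElimGen.plus t)

/-- The basis element `D_t⁻`. -/
noncomputable def Dm (t : TreeClass) : InsElim := stdBasis (InsElimGen.minus t)

open TreeClass

open Classical in
/-- The bracket of `D_s⁻` with `D_t⁺`. -/
noncomputable def bracketMinusPlus (s t : TreeClass) : InsElim :=
  if s = t then d
  else (∑ᶠ r : TreeClass, (alpha s t r : ℂ) • Dp r) + ∑ᶠ r : TreeClass, (beta s t r : ℂ) • Dm r

/-- The brackets of the elements of the standard basis. -/
noncomputable def bracketGen : InsElimGen → InsElimGen → InsElim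
  | .d, .d => 0
  | .d, .plus t => (size t : ℂ) • Dp t
  | .d, .minus t => -(size t : ℂ) • Dm t
  | .plus t, .d => -((size t : ℂ) • Dp t)
  | .minus t, .d => -(-(size t : ℂ) • Dm t)
  | .plus s, .plus t => ∑ᶠ r : TreeClass, ((beta r s t : ℂ) - (beta r t s : ℂ)) • Dp r
  | .minus s, .minus t => ∑ᶠ r : TreeClass, ((alpha t r s : ℂ) - (alpha s r t : ℂ)) • Dm r
  | .minus s, .plus t => bracketMinusPlus s t
  | .plus s, .minus t => -bracketMinusPlus t s

/-- The bracket, extended bilinearly from the standard basis. -/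
noncomputable def bracketLin : InsElim →ₗ[ℂ] InsElim →ₗ[ℂ] InsElim :=
  stdBasis.constr ℂ fun a => stdBasis.constr ℂ fun b => bracketGen a b

noncomputable instance : Bracket InsElim InsElim := ⟨fun x y => bracketLin x y⟩

end InsElim

/-! Everything from here to the `LieRing` instance only serves to prove that the bracket defined above satisfies the axioms
of a Lie algebra: the elements `d`, `D_t⁺`, `D_t⁻` are compared with linear operators on the span of
the rooted trees, which count vertices, insert trees and eliminate trees. -/

namespace RTree

theorem upper_ne_lower : ∀ {t : RTree} (e : Edge t), upper e ≠ lower e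
  | _, Edge.top i => by simp [upper, lower]
  | _, Edge.child i e => by
    intro h
    simp only [upper, lower, Vert.child.injEq, heq_eq_eq, true_and] at h
    exact upper_ne_lower e h

theorem graph_adj {t : RTree} (a b : Vert t) :
    (graph t).Adj a b ↔ ∃ e : Edge t, (upper e = a ∧ lower e = b) ∨ (upper e = b ∧ lower e = a) := by
  simp only [graph, SimpleGraph.fromEdgeSet_adj, Set.mem_range, Sym2.eq_iff]
  constructor
  · rintro ⟨⟨e, he⟩, -⟩
    exact ⟨e, he⟩
  · rintro ⟨e, he⟩
    refine ⟨⟨e, he⟩, ?_⟩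
    rcases he with ⟨rfl, rfl⟩ | ⟨rfl, rfl⟩
    · exact upper_ne_lower e
    · exact (upper_ne_lower e).symm

theorem adj_root {n : ℕ} {c : Fin n → RTree} (x : Vert (node n c)) :
    (graph (node n c)).Adj Vert.root x ↔ ∃ i, x = Vert.child i (rt (c i)) := by
  rw [graph_adj]
  constructor
  · rintro ⟨e, ⟨h1, h2⟩ | ⟨h1, h2⟩⟩
    · cases e with
      | top i => exact ⟨i, h2.symm⟩
      | child i e => simp [upper] at h1
    · cases e with
      | top i => simp [lower] at h2
      | child i e => simp [lower] at h2
  · rintro ⟨i, rfl⟩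
    exact ⟨Edge.top i, Or.inl ⟨rfl, rfl⟩⟩

theorem adj_child {n : ℕ} {c : Fin n → RTree} (i : Fin n) (a b : Vert (c i)) :
    (graph (node n c)).Adj (Vert.child i a) (Vert.child i b) ↔ (graph (c i)).Adj a b := by
  rw [graph_adj, graph_adj]
  constructor
  · rintro ⟨e, ⟨h1, h2⟩ | ⟨h1, h2⟩⟩
    · cases e with
      | top i => simp [upper] at h1
      | child j e =>
        simp only [upper, lower, Vert.child.injEq] at h1 h2
        obtain ⟨rfl, h1⟩ := h1
        exact ⟨e, Or.inl ⟨eq_of_heq h1, eq_of_heq h2.2⟩⟩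
    · cases e with
      | top i => simp [upper] at h1
      | child j e =>
        simp only [upper, lower, Vert.child.injEq] at h1 h2
        obtain ⟨rfl, h1⟩ := h1
        exact ⟨e, Or.inr ⟨eq_of_heq h1, eq_of_heq h2.2⟩⟩
  · rintro ⟨e, ⟨rfl, rfl⟩ | ⟨rfl, rfl⟩⟩
    · exact ⟨Edge.child i e, Or.inl ⟨rfl, rfl⟩⟩
    · exact ⟨Edge.child i e, Or.inr ⟨rfl, rfl⟩⟩

theorem adj_child_index {n : ℕ} {c : Fin n → RTree} {i j : Fin n} {a : Vert (c i)} {b : Vert (c j)}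
    (h : (graph (node n c)).Adj (Vert.child i a) (Vert.child j b)) : i = j := by
  rw [graph_adj] at h
  rcases h with ⟨e, ⟨h1, h2⟩ | ⟨h1, h2⟩⟩ <;> cases e with
    | top i => simp [upper] at h1
    | child k e =>
      simp only [upper, lower, Vert.child.injEq] at h1 h2
      first
        | exact h1.1.symm.trans h2.1
        | exact h2.1.symm.trans h1.1

theorem edge_induction {t : RTree} (p : Vert t → Prop) (h0 : p (rt t))
    (h1 : ∀ a b, (graph t).Adj a b → p a → p b) : ∀ v, p v := by
  induction t with
  | node n c ih =>
    intro v
    cases v with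
    | root => exact h0
    | child i v =>
      exact ih i (fun v => p (Vert.child i v))
        (h1 _ _ ((adj_root _).2 ⟨i, rfl⟩) h0)
        (fun a b hab => h1 _ _ ((adj_child i a b).2 hab)) v

theorem isIso_of_bijective {s t : RTree} (f : Vert s → Vert t) (hf : Function.Bijective f)
    (h : ∀ a b, (graph t).Adj (f a) (f b) ↔ (graph s).Adj a b) (h0 : f (rt s) = rt t) :
    IsIso s t :=
  ⟨⟨Equiv.ofBijective f hf, fun {a b} => h a b⟩, h0⟩

theorem isIso_node {n m : ℕ} {c : Fin n → RTree} {c' : Fin m → RTree} (σ : Fin n ≃ Fin m)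
    (h : ∀ i, IsIso (c i) (c' (σ i))) : IsIso (node n c) (node m c') := by
  choose f hf using h
  refine isIso_of_bijective (fun v : Vert (node n c) => (match v with
    | Vert.root => Vert.root
    | Vert.child i v => Vert.child (σ i) (f i v) : Vert (node m c'))) ⟨?_, ?_⟩ ?_ rfl
  · intro a b hab
    cases a with
    | root => cases b with
      | root => rfl
      | child j b => simp at hab
    | child i a => cases b with
      | root => simp at hab
      | child j b =>
        simp only [Vert.child.injEq, EmbeddingLike.apply_eq_iff_eq] at hab
        obtain ⟨rfl, hab⟩ := hab
        rw [(f i).injective (eq_of_heq hab)]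
  · intro b
    cases b with
    | root => exact ⟨Vert.root, rfl⟩
    | child j b =>
      obtain ⟨i, rfl⟩ := σ.surjective j
      obtain ⟨a, rfl⟩ := (f i).surjective b
      exact ⟨Vert.child i a, rfl⟩
  · have key : ∀ b, (graph (node m c')).Adj Vert.root (match b with
        | Vert.root => Vert.root
        | Vert.child i v => Vert.child (σ i) (f i v) : Vert (node m c')) ↔
        (graph (node n c)).Adj Vert.root b := by
      intro b
      rw [adj_root, adj_root]
      cases b with
      | root => simp
      | child j b =>
        simp only [Vert.child.injEq]
        constructor
        · rintro ⟨i, rfl, h⟩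
          refine ⟨j, rfl, heq_of_eq ?_⟩
          apply (f j).injective
          rw [hf]
          exact eq_of_heq h
        · rintro ⟨i, rfl, h⟩
          refine ⟨_, rfl, heq_of_eq ?_⟩
          rw [eq_of_heq h, hf]
    intro a b
    cases a with
    | root => exact key b
    | child i a => cases b with
      | root =>
        rw [SimpleGraph.adj_comm, SimpleGraph.adj_comm (graph (node n c))]
        exact key (Vert.child i a)
      | child j b =>
        constructor
        · intro h
          have := σ.injective (adj_child_index h)
          subst this
          exact (adj_child _ _ _).2 ((f i).map_adj_iff.1 ((adj_child _ _ _).1 h))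
        · intro h
          have := adj_child_index h
          subst this
          exact (adj_child _ _ _).2 ((f i).map_adj_iff.2 ((adj_child _ _ _).1 h))

theorem isIso_block {n m : ℕ} {c : Fin n → RTree} {c' : Fin m → RTree}
    (f : graph (node n c) ≃g graph (node m c')) (hf : f Vert.root = Vert.root) (i : Fin n)
    (j : Fin m) (h : f (Vert.child i (rt (c i))) = Vert.child j (rt (c' j))) :
    ∀ v, ∃ w, f (Vert.child i v) = Vert.child j w := by
  apply edge_induction
  · exact ⟨_, h⟩
  · rintro a b hab ⟨w, hw⟩
    have h2 := f.map_adj_iff.2 ((adj_child i a b).2 hab)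
    rw [hw] at h2
    cases hx : f (Vert.child i b) with
    | root =>
      rw [← hf] at hx
      exact absurd (f.injective hx) (by simp)
    | child k x =>
      rw [hx] at h2
      have := adj_child_index h2
      subst this
      exact ⟨x, rfl⟩

theorem exists_of_isIso_node {n m : ℕ} {c : Fin n → RTree} {c' : Fin m → RTree}
    (h : IsIso (node n c) (node m c')) :
    ∃ σ : Fin n ≃ Fin m, ∀ i, IsIso (c i) (c' (σ i)) := by
  obtain ⟨f, hf⟩ := h
  change f Vert.root = Vert.root at hf
  have hf' : f.symm Vert.root = Vert.root := by rw [← hf]; exact f.symm_apply_apply _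
  have h1 : ∀ i, ∃ j, f (Vert.child i (rt (c i))) = Vert.child j (rt (c' j)) := by
    intro i
    rw [← adj_root, ← hf]
    exact f.map_adj_iff.2 ((adj_root _).2 ⟨i, rfl⟩)
  have h2 : ∀ j, ∃ i, f.symm (Vert.child j (rt (c' j))) = Vert.child i (rt (c i)) := by
    intro i
    rw [← adj_root, ← hf']
    exact f.symm.map_adj_iff.2 ((adj_root _).2 ⟨i, rfl⟩)
  choose σ hσ using h1
  choose τ hτ using h2
  have e1 : ∀ i, τ (σ i) = i := by
    intro i
    have := hτ (σ i)
    rw [← hσ, RelIso.symm_apply_apply] at this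
    simp only [Vert.child.injEq] at this
    exact this.1.symm
  have e2 : ∀ i, σ (τ i) = i := by
    intro i
    have := hσ (τ i)
    rw [← hτ, RelIso.apply_symm_apply] at this
    simp only [Vert.child.injEq] at this
    exact this.1.symm
  refine ⟨⟨σ, τ, e1, e2⟩, fun i => ?_⟩
  change IsIso (c i) (c' (σ i))
  choose g hg using isIso_block f hf i (σ i) (hσ i)
  refine isIso_of_bijective g ⟨?_, ?_⟩ ?_ ?_
  · intro a b hab
    have := f.injective ((hg a).trans ((congrArg _ hab).trans (hg b).symm))
    simpa using this
  · intro w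
    obtain ⟨v, hv⟩ := isIso_block f.symm hf' (σ i) i
      (by rw [← hσ, RelIso.symm_apply_apply]) w
    refine ⟨v, ?_⟩
    have h3 := hg v
    rw [← hv, RelIso.apply_symm_apply] at h3
    simpa using h3.symm
  · intro a b
    rw [← adj_child, ← hg, ← hg, f.map_adj_iff, adj_child]
  · have := (hg _).symm.trans (hσ i)
    simpa using this

end RTree

namespace RTree

/-- The vertices of a rooted tree, by components. -/
def vertEquiv {n : ℕ} (c : Fin n → RTree) :
    Vert (node n c) ≃ Option ((i : Fin n) × Vert (c i)) where
  toFun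
    | Vert.root => none
    | Vert.child i v => some ⟨i, v⟩
  invFun
    | none => Vert.root
    | some ⟨i, v⟩ => Vert.child i v
  left_inv v := by cases v <;> rfl
  right_inv v := by rcases v with _ | ⟨i, v⟩ <;> rfl

/-- The edges of a rooted tree, by components. -/
def edgeEquiv {n : ℕ} (c : Fin n → RTree) :
    Edge (node n c) ≃ (i : Fin n) × Option (Edge (c i)) where
  toFun
    | Edge.top i => ⟨i, none⟩
    | Edge.child i v => ⟨i, some v⟩
  invFun
    | ⟨i, none⟩ => Edge.top i
    | ⟨i, some v⟩ => Edge.child i v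
  left_inv v := by cases v <;> rfl
  right_inv v := by rcases v with ⟨i, _ | v⟩ <;> rfl

instance finite_vert (t : RTree) : Finite (Vert t) := by
  induction t with
  | node n c ih => exact Finite.of_equiv _ (vertEquiv c).symm

instance finite_edge (t : RTree) : Finite (Edge t) := by
  induction t with
  | node n c ih => exact Finite.of_equiv _ (edgeEquiv c).symm

noncomputable instance (t : RTree) : Fintype (Vert t) := Fintype.ofFinite _
noncomputable instance (t : RTree) : Fintype (Edge t) := Fintype.ofFinite _

theorem sum_vert {M : Type*} [AddCommMonoid M] {n : ℕ} (c : Fin n → RTree)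
    (f : Vert (node n c) → M) :
    ∑ v, f v = f Vert.root + ∑ i, ∑ v, f (Vert.child i v) := by
  rw [← (vertEquiv c).symm.sum_comp, Fintype.sum_option, Fintype.sum_sigma]
  rfl

theorem sum_edge {M : Type*} [AddCommMonoid M] {n : ℕ} (c : Fin n → RTree)
    (f : Edge (node n c) → M) :
    ∑ v, f v = ∑ i, (f (Edge.top i) + ∑ v, f (Edge.child i v)) := by
  rw [← (edgeEquiv c).symm.sum_comp, Fintype.sum_sigma]
  simp only [Fintype.sum_option]
  rfl

theorem card_node {n : ℕ} (c : Fin n → RTree) :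
    Nat.card (Vert (node n c)) = 1 + ∑ i, Nat.card (Vert (c i)) := by
  rw [Nat.card_congr (vertEquiv c), Finite.card_option, Nat.card_sigma, add_comm]

theorem card_update {n : ℕ} (c : Fin n → RTree) (i : Fin n) (t : RTree) :
    Nat.card (Vert (node n (Function.update c i t))) + Nat.card (Vert (c i)) =
      Nat.card (Vert (node n c)) + Nat.card (Vert t) := by
  rw [card_node, card_node, ← Finset.add_sum_erase _ _ (Finset.mem_univ i),
    ← Finset.add_sum_erase _ (fun i => Nat.card (Vert (c i))) (Finset.mem_univ i)]
  have : ∑ x ∈ Finset.univ.erase i, Nat.card (Vert (Function.update c i t x)) =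
      ∑ x ∈ Finset.univ.erase i, Nat.card (Vert (c x)) := by
    refine Finset.sum_congr rfl fun j hj => ?_
    rw [Function.update_of_ne (Finset.ne_of_mem_erase hj)]
  rw [this, Function.update_self]
  omega

theorem card_graft (t s : RTree) (v : Vert t) :
    Nat.card (Vert (graft t v s)) = Nat.card (Vert t) + Nat.card (Vert s) := by
  induction v with
  | root =>
    rw [graft, card_node, card_node, Fin.sum_univ_succ]
    simp only [Fin.cons_zero, Fin.cons_succ]
    omega
  | @child n c i v ih =>
    have := card_update c i (graft (c i) v s)
    rw [graft]
    omega

theorem card_cut (t : RTree) (e : Edge t) :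
    Nat.card (Vert (trunk t e)) + Nat.card (Vert (pruned t e)) = Nat.card (Vert t) := by
  induction e with
  | @top n c i =>
    cases n with
    | zero => exact i.elim0
    | succ n =>
      rw [trunk, pruned, eraseChild, card_node, card_node, Fin.sum_univ_succAbove _ i]
      omega
  | @child n c i e ih =>
    have := card_update c i (trunk (c i) e)
    rw [trunk, pruned]
    omega

end RTree

namespace TreeClass

open RTree MvPolynomial

theorem mk_eq {s t : RTree} : mk s = mk t ↔ IsIso s t := Quotient.eq

theorem mk_rep (t : TreeClass) : mk t.rep = t := Quotient.out_eq t

theorem ind {p : TreeClass → Prop} (h : ∀ t, p (mk t)) (t : TreeClass) : p t := by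
  rw [← mk_rep t]
  exact h _

theorem mk_node {n m : ℕ} {c : Fin n → RTree} {c' : Fin m → RTree} (σ : Fin n ≃ Fin m)
    (h : ∀ i, mk (c i) = mk (c' (σ i))) : mk (node n c) = mk (node m c') :=
  mk_eq.2 (isIso_node σ fun i => mk_eq.1 (h i))

theorem size_mk (t : RTree) : size (mk t) = Nat.card (Vert t) := by
  obtain ⟨f, -⟩ := mk_eq.1 (mk_rep (mk t))
  exact Nat.card_congr f.toEquiv

theorem size_of_alpha {s t r : TreeClass} (h : alpha s t r ≠ 0) : size t = size s + size r := by
  obtain ⟨⟨e, h1, h2⟩⟩ := (Nat.card_ne_zero.1 h).1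
  rw [← h1, ← h2, size_mk, size_mk, add_comm, card_cut]
  rfl

theorem size_of_beta {r s t : TreeClass} (h : beta r s t ≠ 0) : size r = size s + size t := by
  obtain ⟨⟨e, h1⟩⟩ := (Nat.card_ne_zero.1 h).1
  rw [h1, size_mk, card_graft, add_comm]
  rfl

theorem size_pos (t : TreeClass) : 0 < size t :=
  Nat.card_pos_iff.2 ⟨⟨rt _⟩, inferInstance⟩

theorem finite_size (n : ℕ) : {r : TreeClass | size r ≤ n}.Finite := by
  have key : ∀ n, {r : TreeClass | size r = n}.Finite := by
    intro n
    have e : ∀ r : {r : TreeClass | size r = n}, Vert r.1.rep ≃ Fin n :=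
      fun r => Finite.equivFinOfCardEq r.2
    refine Finite.of_injective (β := SimpleGraph (Fin n) × Fin n)
      (fun r : {r : TreeClass | size r = n} => ((graph r.1.rep).map (e r), e r (rt r.1.rep))) ?_
    intro r r' h
    simp only [Prod.mk.injEq] at h
    apply Subtype.ext
    rw [← mk_rep r.1, ← mk_rep r'.1, mk_eq]
    refine ⟨⟨(e r).trans (e r').symm, fun {a b} => ?_⟩, ?_⟩
    · have h1 : ∀ (r : {r : TreeClass | size r = n}) (a b : Vert r.1.rep),
          ((graph r.1.rep).map (e r)).Adj (e r a) (e r b) ↔ (graph r.1.rep).Adj a b := fun r a b =>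
        SimpleGraph.map_adj_apply (f := (e r).toEmbedding)
      rw [← h1, ← h1 r, h.1]
      simp
    · change (e r').symm (e r (rt r.1.rep)) = rt r'.1.rep
      rw [h.2, Equiv.symm_apply_apply]
  have : {r : TreeClass | size r ≤ n} = ⋃ m ∈ Set.Iic n, {r | size r = m} := by
    ext r
    simp
  rw [this]
  exact (Set.finite_Iic n).biUnion fun m _ => key m

/-- Formal linear combinations of isomorphism classes of rooted trees. -/
abbrev Comb : Type := TreeClass →₀ ℂ

/-- The polynomial algebra on the isomorphism classes of rooted trees. -/
abbrev Poly : Type := MvPolynomial TreeClass ℂ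

/-- The multiset of components. -/
noncomputable def compts {n : ℕ} (c : Fin n → RTree) : TreeClass →₀ ℕ :=
  ∑ i, Finsupp.single (mk (c i)) 1

theorem exists_of_compts {n m : ℕ} {c : Fin n → RTree} {c' : Fin m → RTree}
    (h : compts c = compts c') : ∃ σ : Fin n ≃ Fin m, ∀ i, mk (c i) = mk (c' (σ i)) := by
  classical
  have key : ∀ a, Nonempty ({i // mk (c i) = a} ≃ {i // mk (c' i) = a}) := by
    intro a
    have := DFunLike.congr_fun h a
    simp only [compts, Finsupp.finsetSum_apply, Finsupp.single_apply, Finset.sum_boole,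
      Nat.cast_id] at this
    rw [← Fintype.card_eq, Fintype.card_subtype, Fintype.card_subtype, this]
  have e := fun a => (key a).some
  refine ⟨(Equiv.sigmaFiberEquiv fun i => mk (c i)).symm.trans
    ((Equiv.sigmaCongrRight e).trans (Equiv.sigmaFiberEquiv fun i => mk (c' i))), fun i => ?_⟩
  exact ((e (mk (c i))) ⟨i, rfl⟩).2.symm

theorem exists_compts (m : TreeClass →₀ ℕ) :
    ∃ (n : ℕ) (c : Fin n → RTree), compts c = m := by
  classical
  obtain ⟨S, rfl⟩ := Multiset.toFinsupp.surjective m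
  induction S using Multiset.induction with
  | empty => exact ⟨0, Fin.elim0, by simp [compts]⟩
  | cons a S ih =>
    obtain ⟨n, c, hc⟩ := ih
    refine ⟨n + 1, Fin.cons a.rep c, ?_⟩
    rw [← Multiset.singleton_add, map_add, ← hc, compts, Fin.sum_univ_succ]
    simp [mk_rep, compts]

/-- The class of the rooted tree with given components. -/
noncomputable def join (m : TreeClass →₀ ℕ) : TreeClass :=
  mk (node _ (exists_compts m).choose_spec.choose)

theorem join_compts {n : ℕ} (c : Fin n → RTree) : join (compts c) = mk (node n c) := by
  obtain ⟨σ, hσ⟩ := exists_of_compts (exists_compts (compts c)).choose_spec.choose_spec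
  exact mk_node σ hσ

/-- The linear map sending a monomial to the rooted tree with the given components. -/
noncomputable def nodeMap : Poly →ₗ[ℂ] Comb :=
  (basisMonomials TreeClass ℂ).constr ℂ fun m => Finsupp.single (join m) 1

theorem prod_X {n : ℕ} (c : Fin n → RTree) :
    (∏ i, X (mk (c i)) : Poly) = monomial (compts c) 1 := by
  rw [compts, monomial_sum_one]
  rfl

theorem nodeMap_prod {n : ℕ} (c : Fin n → RTree) :
    nodeMap (∏ i, X (mk (c i))) = Finsupp.single (mk (node n c)) 1 := by
  rw [prod_X, ← join_compts, nodeMap]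
  exact (basisMonomials TreeClass ℂ).constr_basis ℂ _ _

theorem poly_ext {M : Type*} [AddCommMonoid M] [Module ℂ M] {f g : Poly →ₗ[ℂ] M}
    (h : ∀ (n : ℕ) (c : Fin n → RTree), f (∏ i, X (mk (c i))) = g (∏ i, X (mk (c i)))) :
    f = g := by
  refine (basisMonomials TreeClass ℂ).ext fun m => ?_
  obtain ⟨n, c, rfl⟩ := exists_compts m
  have := h n c
  rw [prod_X] at this
  exact this

/-- The linear polynomial attached to a linear combination. -/
noncomputable def lin : Comb →ₗ[ℂ] Poly := Finsupp.linearCombination ℂ X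

theorem lin_single (t : TreeClass) : lin (Finsupp.single t 1) = X t := by
  simp [lin]

/-- The derivation extending a linear map. -/
noncomputable def der (P : Module.End ℂ Comb) : Derivation ℂ Poly Poly :=
  mkDerivation ℂ fun r => lin (P (Finsupp.single r 1))

theorem der_X (P : Module.End ℂ Comb) (r : TreeClass) :
    der P (X r) = lin (P (Finsupp.single r 1)) := mkDerivation_X ..

theorem der_lin (P : Module.End ℂ Comb) (x : Comb) : der P (lin x) = lin (P x) := by
  have : (der P).toLinearMap ∘ₗ lin = lin ∘ₗ P := by
    ext t : 2
    simp [lin_single, der_X]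
  exact LinearMap.congr_fun this x

theorem leibniz_prod (D : Derivation ℂ Poly Poly) {ι : Type*} [DecidableEq ι] (s : Finset ι)
    (f : ι → Poly) : D (∏ i ∈ s, f i) = ∑ i ∈ s, (∏ j ∈ s.erase i, f j) * D (f i) := by
  induction s using Finset.induction_on with
  | empty => simp
  | insert a s ha ih =>
    rw [Finset.prod_insert ha, Derivation.leibniz, ih, Finset.sum_insert ha,
      Finset.erase_insert ha, smul_eq_mul, smul_eq_mul, add_comm, Finset.mul_sum]
    congr 1
    refine Finset.sum_congr rfl fun i hi => ?_
    have hne : a ≠ i := fun h => ha (h ▸ hi)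
    rw [Finset.erase_insert_of_ne hne, Finset.prod_insert (fun h => ha (Finset.mem_of_mem_erase h)),
      mul_assoc]

/-- `P` corresponds to `p` plus the derivation extending `P`. -/
def IsLift (P : Module.End ℂ Comb) (p : Poly → Poly) : Prop :=
  ∀ F, P (nodeMap F) = nodeMap (p F + der P F)

theorem IsLift.unique {P Q : Module.End ℂ Comb} {p : Poly → Poly} (hP : IsLift P p)
    (hQ : IsLift Q p) : P = Q := by
  have key : ∀ t : RTree, P (Finsupp.single (mk t) 1) = Q (Finsupp.single (mk t) 1) := by
    intro t
    induction t with
    | node n c ih =>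
      classical
      rw [← nodeMap_prod, hP, hQ, leibniz_prod, leibniz_prod]
      simp only [der_X, ih]
  ext t : 2
  simp only [LinearMap.coe_comp, Function.comp_apply, Finsupp.lsingle_apply]
  exact ind (p := fun t => P (Finsupp.single t 1) = Q (Finsupp.single t 1)) key t

theorem der_add (P Q : Module.End ℂ Comb) : der (P + Q) = der P + der Q :=
  derivation_ext fun i => by simp [der_X]

theorem der_smul (a : ℂ) (P : Module.End ℂ Comb) : der (a • P) = a • der P :=
  derivation_ext fun i => by simp [der_X]

theorem der_zero : der 0 = 0 := derivation_ext fun i => by simp [der_X]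

theorem der_comm (P Q : Module.End ℂ Comb) : der (P * Q - Q * P) = ⁅der P, der Q⁆ :=
  derivation_ext fun i => by simp [der_X, der_lin, Derivation.commutator_apply]

theorem IsLift.add {P Q : Module.End ℂ Comb} {p q : Poly → Poly} (hP : IsLift P p)
    (hQ : IsLift Q q) : IsLift (P + Q) fun F => p F + q F := by
  intro F
  rw [LinearMap.add_apply, hP, hQ, ← map_add, der_add, Derivation.add_apply]
  congr 1
  ring

theorem IsLift.smul {P : Module.End ℂ Comb} {p : Poly → Poly} (hP : IsLift P p) (a : ℂ) :
    IsLift (a • P) fun F => a • p F := by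
  intro F
  rw [LinearMap.smul_apply, hP, ← map_smul, der_smul, Derivation.smul_apply, smul_add]

theorem IsLift.zero : IsLift 0 fun _ => 0 := by
  intro F
  simp [der_zero]

theorem IsLift.comm {P Q : Module.End ℂ Comb} {p q p' : Poly → Poly} (hP : IsLift P p)
    (hQ : IsLift Q q)
    (h : ∀ F, p' F = p (q F + der Q F) + der P (q F) - q (p F + der P F) - der Q (p F)) :
    IsLift (P * Q - Q * P) p' := by
  intro F
  rw [LinearMap.sub_apply, Module.End.mul_apply, Module.End.mul_apply, hP, hQ, hP, hQ, ← map_sub,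
    der_comm, Derivation.commutator_apply, h]
  refine congrArg nodeMap ?_
  have aux : ∀ a b c d e f : Poly,
      a + (b + c) - (d + (e + f)) = a + b - d - e + (c - f) := fun a b c d e f => by abel
  rw [map_add (der P), map_add (der Q)]
  exact aux _ _ _ _ _ _

theorem IsLift.linearCombination {P : TreeClass → Module.End ℂ Comb}
    {p : TreeClass → Poly → Poly} (h : ∀ r, IsLift (P r) (p r)) (w : TreeClass →₀ ℂ) :
    IsLift (Finsupp.linearCombination ℂ P w) fun F => w.sum fun r a => a • p r F := by
  classical
  have key : ∀ S : Finset TreeClass,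
      IsLift (∑ r ∈ S, w r • P r) fun F => ∑ r ∈ S, w r • p r F := by
    intro S
    induction S using Finset.induction_on with
    | empty => simpa using IsLift.zero
    | insert a S ha ih =>
      simp only [Finset.sum_insert ha]
      exact ((h a).smul _).add ih
  exact key w.support

/-- Replacing the component `c i` by a linear combination. -/
noncomputable def slot {n : ℕ} (c : Fin n → RTree) (i : Fin n) : Comb →ₗ[ℂ] Comb :=
  nodeMap ∘ₗ LinearMap.mulLeft ℂ (∏ j ∈ Finset.univ.erase i, X (mk (c j))) ∘ₗ lin

theorem slot_apply {n : ℕ} (c : Fin n → RTree) (i : Fin n) (x : Comb) :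
    slot c i x = nodeMap ((∏ j ∈ Finset.univ.erase i, X (mk (c j))) * lin x) := rfl

theorem slot_single {n : ℕ} (c : Fin n → RTree) (i : Fin n) (t : RTree) :
    slot c i (Finsupp.single (mk t) 1) =
      Finsupp.single (mk (node n (Function.update c i t))) 1 := by
  rw [slot_apply, ← nodeMap_prod, lin_single, ← Finset.prod_erase_mul _ _ (Finset.mem_univ i),
    Function.update_self]
  congr 2
  refine Finset.prod_congr rfl fun j hj => ?_
  rw [Function.update_of_ne (Finset.ne_of_mem_erase hj)]

theorem single_eraseChild {n : ℕ} (c : Fin n → RTree) (i : Fin n) :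
    Finsupp.single (mk (eraseChild c i)) 1 =
      nodeMap (∏ j ∈ Finset.univ.erase i, X (mk (c j))) := by
  cases n with
  | zero => exact i.elim0
  | succ n =>
    rw [eraseChild, ← nodeMap_prod]
    congr 1
    rw [← Finset.compl_singleton, ← Fin.image_succAbove_univ, Finset.prod_image]
    exact fun _ _ _ _ h => Fin.succAbove_right_injective h

/-- Insertion of `s` into `t` at all vertices. -/
noncomputable def insRaw (s : TreeClass) (t : RTree) : Comb :=
  ∑ v : Vert t, Finsupp.single (mk (graft t v s.rep)) 1

open Classical in
/-- Elimination of `s` from `t`. -/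
noncomputable def elimRaw (s : TreeClass) (t : RTree) : Comb :=
  ∑ e : Edge t, if mk (pruned t e) = s then Finsupp.single (mk (trunk t e)) 1 else 0

theorem insRaw_node (s : TreeClass) {n : ℕ} (c : Fin n → RTree) :
    insRaw s (node n c) = nodeMap (X s * ∏ i, X (mk (c i))) + ∑ i, slot c i (insRaw s (c i)) := by
  rw [insRaw, sum_vert]
  simp only [insRaw, map_sum, slot_single, graft]
  rw [← nodeMap_prod, Fin.prod_univ_succ]
  simp only [Fin.cons_zero, Fin.cons_succ, mk_rep]

open Classical in
theorem elimRaw_node (s : TreeClass) {n : ℕ} (c : Fin n → RTree) :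
    elimRaw s (node n c) = ∑ i, ((if mk (c i) = s then
      nodeMap (∏ j ∈ Finset.univ.erase i, X (mk (c j))) else 0) + slot c i (elimRaw s (c i))) := by
  rw [elimRaw, sum_edge]
  refine Finset.sum_congr rfl fun i _ => ?_
  simp only [elimRaw, map_sum, apply_ite (slot c i), map_zero, slot_single, trunk, pruned,
    single_eraseChild]

theorem prod_erase_equiv {n m : ℕ} {c : Fin n → RTree} {c' : Fin m → RTree} (σ : Fin n ≃ Fin m)
    (h : ∀ i, mk (c i) = mk (c' (σ i))) (i : Fin n) :
    (∏ j ∈ Finset.univ.erase i, X (mk (c j)) : Poly) =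
      ∏ j ∈ Finset.univ.erase (σ i), X (mk (c' j)) := by
  refine Finset.prod_equiv σ (by simp) fun j _ => ?_
  rw [h]

theorem insRaw_congr (s : TreeClass) {t t' : RTree} (h : IsIso t t') :
    insRaw s t = insRaw s t' := by
  induction t generalizing t' with
  | node n c ih =>
    cases t' with
    | node m c' =>
      obtain ⟨σ, hσ⟩ := exists_of_isIso_node h
      have hσ' : ∀ i, mk (c i) = mk (c' (σ i)) := fun i => mk_eq.2 (hσ i)
      rw [insRaw_node, insRaw_node]
      congr 1
      · rw [← σ.prod_comp]
        simp only [hσ']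
      · refine Fintype.sum_equiv σ _ _ fun i => ?_
        rw [slot_apply, slot_apply, ih i (hσ i), prod_erase_equiv σ hσ']

theorem elimRaw_congr (s : TreeClass) {t t' : RTree} (h : IsIso t t') :
    elimRaw s t = elimRaw s t' := by
  induction t generalizing t' with
  | node n c ih =>
    cases t' with
    | node m c' =>
      obtain ⟨σ, hσ⟩ := exists_of_isIso_node h
      have hσ' : ∀ i, mk (c i) = mk (c' (σ i)) := fun i => mk_eq.2 (hσ i)
      rw [elimRaw_node, elimRaw_node]
      refine Fintype.sum_equiv σ _ _ fun i => ?_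
      rw [slot_apply, slot_apply, ih i (hσ i), prod_erase_equiv σ hσ', hσ']

/-- The insertion operator. -/
noncomputable def ins (s : TreeClass) : Module.End ℂ Comb :=
  Finsupp.linearCombination ℂ fun t => insRaw s t.rep

/-- The elimination operator. -/
noncomputable def elim (s : TreeClass) : Module.End ℂ Comb :=
  Finsupp.linearCombination ℂ fun t => elimRaw s t.rep

/-- The degree operator. -/
noncomputable def deg : Module.End ℂ Comb :=
  Finsupp.linearCombination ℂ fun t => Finsupp.single t (size t : ℂ)

theorem ins_mk (s : TreeClass) (t : RTree) : ins s (Finsupp.single (mk t) 1) = insRaw s t := by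
  simp only [ins, Finsupp.linearCombination_single, one_smul]
  exact insRaw_congr s (mk_eq.1 (mk_rep _))

theorem elim_mk (s : TreeClass) (t : RTree) : elim s (Finsupp.single (mk t) 1) = elimRaw s t := by
  simp only [elim, Finsupp.linearCombination_single, one_smul]
  exact elimRaw_congr s (mk_eq.1 (mk_rep _))

theorem deg_single (t : TreeClass) :
    deg (Finsupp.single t 1) = (size t : ℂ) • Finsupp.single t 1 := by
  simp [deg]

theorem isLift_of_prod {P : Module.End ℂ Comb} (p : Poly →ₗ[ℂ] Poly)
    (h : ∀ (n : ℕ) (c : Fin n → RTree), P (Finsupp.single (mk (node n c)) 1) =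
      nodeMap (p (∏ i, X (mk (c i)))) +
        ∑ i, slot c i (P (Finsupp.single (mk (c i)) 1))) : IsLift P p := by
  have : P ∘ₗ nodeMap = nodeMap ∘ₗ (p + (der P).toLinearMap) := by
    refine poly_ext fun n c => ?_
    simp only [LinearMap.coe_comp, Function.comp_apply, nodeMap_prod, h, LinearMap.add_apply,
      map_add, Derivation.coeFn_coe, leibniz_prod, map_sum, der_X]
    rfl
  exact fun F => LinearMap.congr_fun this F

theorem isLift_ins (s : TreeClass) : IsLift (ins s) fun F => X s * F := by
  refine isLift_of_prod (LinearMap.mulLeft ℂ (X s)) fun n c => ?_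
  simp only [ins_mk, insRaw_node, LinearMap.mulLeft_apply]

theorem isLift_elim (s : TreeClass) : IsLift (elim s) fun F => pderiv s F := by
  classical
  refine isLift_of_prod (pderiv s).toLinearMap fun n c => ?_
  simp only [elim_mk, elimRaw_node, Derivation.coeFn_coe,
    leibniz_prod, map_sum, Finset.sum_add_distrib]
  congr 1
  refine Finset.sum_congr rfl fun i _ => ?_
  rw [pderiv_X, Pi.single_apply]
  split_ifs <;> simp

theorem isLift_deg : IsLift deg fun F => F := by
  refine isLift_of_prod LinearMap.id fun n c => ?_
  have : ∀ i, slot c i (deg (Finsupp.single (mk (c i)) 1)) =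
      (size (mk (c i)) : ℂ) • nodeMap (∏ j, X (mk (c j))) := by
    intro i
    rw [deg_single, map_smul, slot_single, Function.update_eq_self, nodeMap_prod]
  simp only [this, ← Finset.sum_smul]
  rw [LinearMap.id_apply, deg_single, nodeMap_prod]
  rw [size_mk, card_node]
  simp only [size_mk]
  push_cast
  rw [add_smul, one_smul]

end TreeClass

namespace TreeClass

open RTree MvPolynomial

theorem ins_coeff (r s t : TreeClass) : ins s (Finsupp.single t 1) r = (beta r s t : ℂ) := by
  classical
  rw [ins, Finsupp.linearCombination_single, one_smul, insRaw, Finsupp.finsetSum_apply, beta]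
  simp only [Finsupp.single_apply, Finset.sum_boole]
  rw [Nat.card_eq_fintype_card, Fintype.card_subtype]
  simp only [eq_comm]

theorem elim_coeff (s t r : TreeClass) : elim s (Finsupp.single t 1) r = (alpha s t r : ℂ) := by
  classical
  rw [elim, Finsupp.linearCombination_single, one_smul, elimRaw, Finsupp.finsetSum_apply, alpha]
  have : ∀ e : Edge t.rep, (if mk (pruned t.rep e) = s then
      (Finsupp.single (mk (trunk t.rep e)) (1 : ℂ)) else 0 : Comb) r =
      if mk (trunk t.rep e) = r ∧ mk (pruned t.rep e) = s then 1 else 0 := by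
    intro e
    by_cases h : mk (pruned t.rep e) = s <;> simp [h, Finsupp.single_apply]
  simp only [this, Finset.sum_boole]
  rw [Nat.card_eq_fintype_card, Fintype.card_subtype]

/-- The coefficients `β(s, t, r)` as a combination of the trees `r`. -/
noncomputable def betaVec (s t : TreeClass) : Comb :=
  Finsupp.ofSupportFinite (fun r => (beta s t r : ℂ)) <|
    (finite_size (size s)).subset fun r hr => by
      have := size_of_beta (Nat.cast_ne_zero.1 hr)
      simp only [Set.mem_ofPred_eq]
      omega

/-- The coefficients `α(s, r, t)` as a combination of the trees `r`. -/
noncomputable def alphaVec (s t : TreeClass) : Comb :=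
  Finsupp.ofSupportFinite (fun r => (alpha s r t : ℂ)) <|
    (finite_size (size s + size t)).subset fun r hr => by
      have := size_of_alpha (Nat.cast_ne_zero.1 hr)
      simp only [Set.mem_ofPred_eq]
      omega

theorem betaVec_apply (s t r : TreeClass) : betaVec s t r = (beta s t r : ℂ) := rfl

theorem alphaVec_apply (s t r : TreeClass) : alphaVec s t r = (alpha s r t : ℂ) := rfl

theorem isLift_lc_ins (w : Comb) :
    IsLift (Finsupp.linearCombination ℂ ins w) fun F => lin w * F := by
  have := IsLift.linearCombination isLift_ins w
  have e : (fun F => w.sum fun r a => a • (X r * F : Poly)) = fun F => lin w * F := by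
    funext F
    rw [lin, Finsupp.linearCombination_apply, Finsupp.sum_mul]
    simp only [smul_mul_assoc]
  rwa [e] at this

theorem sum_der_apply (S : Finset TreeClass) (D : TreeClass → Derivation ℂ Poly Poly) (F : Poly) :
    (∑ r ∈ S, D r) F = ∑ r ∈ S, D r F := by
  rw [← Derivation.coeFnAddMonoidHom_apply, map_sum, Finset.sum_apply]
  rfl

theorem isLift_lc_elim (w : Comb) (D : Derivation ℂ Poly Poly) (hD : ∀ r, D (X r) = C (w r)) :
    IsLift (Finsupp.linearCombination ℂ elim w) fun F => D F := by
  classical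
  have := IsLift.linearCombination isLift_elim w
  have e : D = w.sum fun r a => a • (pderiv r : Derivation ℂ Poly Poly) := by
    refine derivation_ext fun i => ?_
    rw [hD, Finsupp.sum, sum_der_apply]
    simp only [Derivation.smul_apply, pderiv_X, Pi.single_apply, smul_ite, smul_zero]
    rw [Finset.sum_ite_eq, smul_eq_C_mul, mul_one]
    split_ifs with h
    · rfl
    · rw [Finsupp.notMem_support_iff.1 h, C_0]
  have e2 : (fun F => w.sum fun r a => a • (pderiv r F : Poly)) = fun F => D F := by
    funext F
    rw [e, Finsupp.sum, Finsupp.sum, sum_der_apply]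
    rfl
  rwa [e2] at this

theorem pderiv_lin (s : TreeClass) (x : Comb) : pderiv s (lin x) = C (x s) := by
  classical
  have : (pderiv s).toLinearMap ∘ₗ lin =
      (Algebra.linearMap ℂ Poly) ∘ₗ (Finsupp.lapply s : Comb →ₗ[ℂ] ℂ) := by
    ext t : 2
    simp only [LinearMap.coe_comp, Function.comp_apply, Finsupp.lsingle_apply, lin_single,
      Derivation.coeFn_coe, pderiv_X, Pi.single_apply, Finsupp.lapply_apply, Finsupp.single_apply,
      Algebra.linearMap_apply]
    split_ifs <;> simp_all
  exact LinearMap.congr_fun this x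

theorem ins_ins (s t : TreeClass) : ins s * ins t - ins t * ins s =
    Finsupp.linearCombination ℂ ins (ins s (Finsupp.single t 1) - ins t (Finsupp.single s 1)) := by
  refine ((isLift_ins s).comm (isLift_ins t) fun F => ?_).unique (isLift_lc_ins _)
  rw [Derivation.leibniz, Derivation.leibniz, der_X, der_X, map_sub]
  simp only [smul_eq_mul]
  ring

open Classical in
theorem elim_ins (s t : TreeClass) : elim s * ins t - ins t * elim s =
    (if s = t then deg else 0) + Finsupp.linearCombination ℂ ins (elim s (Finsupp.single t 1)) +
      Finsupp.linearCombination ℂ elim (betaVec s t) := by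
  have h0 : IsLift (if s = t then deg else 0) fun F => (if s = t then 1 else 0) * F := by
    split_ifs
    · simpa using isLift_deg
    · simpa using IsLift.zero
  refine ((isLift_elim s).comm (isLift_ins t) fun F => ?_).unique
    ((h0.add (isLift_lc_ins _)).add
      (isLift_lc_elim _ ⁅(pderiv s : Derivation ℂ Poly Poly), der (ins t)⁆ fun r => ?_))
  · rw [Derivation.commutator_apply, map_add, Derivation.leibniz, Derivation.leibniz, der_X,
      pderiv_X, Pi.single_apply]
    simp only [smul_eq_mul, eq_comm (a := t)]
    ring
  · rw [Derivation.commutator_apply, der_X, pderiv_lin, ins_coeff, betaVec_apply, pderiv_X,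
      Pi.single_apply]
    split_ifs <;> simp

open Classical in
theorem elim_elim (s t : TreeClass) : elim s * elim t - elim t * elim s =
    Finsupp.linearCombination ℂ elim (alphaVec t s - alphaVec s t) := by
  refine ((isLift_elim s).comm (isLift_elim t) fun F => ?_).unique
    (isLift_lc_elim _ (⁅(pderiv s : Derivation ℂ Poly Poly), pderiv t⁆ +
      (⁅(pderiv s : Derivation ℂ Poly Poly), der (elim t)⁆ +
      ⁅der (elim s), (pderiv t : Derivation ℂ Poly Poly)⁆)) fun r => ?_)
  · simp only [Derivation.add_apply, Derivation.commutator_apply, map_add]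
    ring
  · simp only [Derivation.add_apply, Derivation.commutator_apply, der_X, pderiv_lin, elim_coeff,
      Finsupp.sub_apply, alphaVec_apply, pderiv_X, Pi.single_apply, C_sub, apply_ite, map_zero,
      Derivation.map_one_eq_zero, ite_self]
    ring

theorem deg_ins (t : TreeClass) : deg * ins t - ins t * deg = (size t : ℂ) • ins t := by
  refine (isLift_deg.comm (isLift_ins t) fun F => ?_).unique ((isLift_ins t).smul _)
  rw [Derivation.leibniz, der_X, deg_single, map_smul, lin_single, smul_eq_mul, smul_eq_mul,
    mul_smul_comm, mul_comm F, mul_add]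
  abel

open Classical in
theorem deg_elim (t : TreeClass) : deg * elim t - elim t * deg = -(size t : ℂ) • elim t := by
  have : -(size t : ℂ) • (pderiv t : Derivation ℂ Poly Poly) = ⁅der deg, pderiv t⁆ := by
    refine derivation_ext fun i => ?_
    rw [Derivation.commutator_apply, der_X, deg_single, map_smul, lin_single, Derivation.smul_apply,
      Derivation.map_smul, pderiv_X, Pi.single_apply]
    split_ifs with h
    · simp [h]
    · simp
  refine (isLift_deg.comm (isLift_elim t) fun F => ?_).unique ((isLift_elim t).smul _)
  rw [← Derivation.smul_apply, this, Derivation.commutator_apply, map_add]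
  abel

end TreeClass

namespace InsElim

open TreeClass RTree MvPolynomial

/-- The action of the insertion-elimination algebra on linear combinations of rooted trees. -/
noncomputable def action : InsElim →ₗ[ℂ] Module.End ℂ Comb :=
  stdBasis.constr ℂ fun
    | .d => deg
    | .plus t => ins t
    | .minus t => TreeClass.elim t

theorem action_d : action d = deg := stdBasis.constr_basis ℂ _ _

theorem action_Dp (t : TreeClass) : action (Dp t) = ins t := stdBasis.constr_basis ℂ _ _

theorem action_Dm (t : TreeClass) : action (Dm t) = TreeClass.elim t :=
  stdBasis.constr_basis ℂ _ _

theorem finsum_eq {M : Type*} [AddCommGroup M] [Module ℂ M] (w : Comb) (g : TreeClass → M) :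
    ∑ᶠ r, w r • g r = Finsupp.linearCombination ℂ g w := by
  rw [Finsupp.linearCombination_apply, Finsupp.sum]
  refine finsum_eq_sum_of_support_subset _ fun r hr => ?_
  rw [Finset.mem_coe, Finsupp.mem_support_iff]
  rintro h
  simp [h] at hr

theorem action_finsum_Dp (w : Comb) :
    action (∑ᶠ r, w r • Dp r) = Finsupp.linearCombination ℂ ins w := by
  rw [finsum_eq, Finsupp.linearCombination_apply, Finsupp.linearCombination_apply, Finsupp.sum,
    Finsupp.sum, map_sum]
  simp only [map_smul, action_Dp]

theorem action_finsum_Dm (w : Comb) :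
    action (∑ᶠ r, w r • Dm r) = Finsupp.linearCombination ℂ TreeClass.elim w := by
  rw [finsum_eq, Finsupp.linearCombination_apply, Finsupp.linearCombination_apply, Finsupp.sum,
    Finsupp.sum, map_sum]
  simp only [map_smul, action_Dm]

theorem action_bracketMinusPlus (s t : TreeClass) : action (bracketMinusPlus s t) =
    TreeClass.elim s * ins t - ins t * TreeClass.elim s := by
  rw [elim_ins, bracketMinusPlus]
  split_ifs with h
  · subst h
    have h1 : TreeClass.elim s (Finsupp.single s 1) = 0 := by
      ext r
      rw [elim_coeff]
      by_contra hne
      have := size_of_alpha (Nat.cast_ne_zero.1 hne)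
      have := size_pos r
      omega
    have h2 : betaVec s s = 0 := by
      ext r
      rw [betaVec_apply]
      by_contra hne
      have := size_of_beta (Nat.cast_ne_zero.1 hne)
      have := size_pos r
      omega
    rw [h1, h2, action_d]
    simp
  · rw [map_add, zero_add, ← action_finsum_Dp, ← action_finsum_Dm]
    simp only [elim_coeff, betaVec_apply]

theorem action_bracketGen (a b : InsElimGen) (m : Comb) : action (bracketGen a b) m =
    action (stdBasis a) (action (stdBasis b) m) - action (stdBasis b) (action (stdBasis a) m) := by
  have hd : action (stdBasis .d) = deg := action_d
  have hp : ∀ t, action (stdBasis (.plus t)) = ins t := action_Dp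
  have hm : ∀ t, action (stdBasis (.minus t)) = TreeClass.elim t := action_Dm
  have h1 : ∀ t, deg (ins t m) - ins t (deg m) = (size t : ℂ) • ins t m :=
    fun t => LinearMap.congr_fun (deg_ins t) m
  have h2 : ∀ t, deg (TreeClass.elim t m) - TreeClass.elim t (deg m) =
      -(size t : ℂ) • TreeClass.elim t m := fun t => LinearMap.congr_fun (deg_elim t) m
  have h3 : ∀ s t, action (bracketMinusPlus s t) m =
      TreeClass.elim s (ins t m) - ins t (TreeClass.elim s m) :=
    fun s t => LinearMap.congr_fun (action_bracketMinusPlus s t) m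
  cases a with
  | d => cases b with
    | d => rw [bracketGen, map_zero, sub_self]; rfl
    | plus t => rw [bracketGen, hd, hp, h1, map_smul, action_Dp]; rfl
    | minus t => rw [bracketGen, hd, hm, h2, map_smul, action_Dm]; rfl
  | plus s => cases b with
    | d => rw [bracketGen, hd, hp, ← neg_sub, h1, map_neg, map_smul, action_Dp]; rfl
    | plus t =>
      have := action_finsum_Dp (ins s (Finsupp.single t 1) - ins t (Finsupp.single s 1))
      rw [← ins_ins] at this
      simp only [Finsupp.sub_apply, ins_coeff] at this
      rw [bracketGen, this, hp, hp]; rfl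
    | minus t => rw [bracketGen, hm, hp, ← neg_sub, ← h3, map_neg]; rfl
  | minus s => cases b with
    | d => rw [bracketGen, hd, hm, ← neg_sub, h2, map_neg, map_smul, action_Dm]; rfl
    | plus t => rw [bracketGen, hp, hm, h3]
    | minus t =>
      have := action_finsum_Dm (alphaVec t s - alphaVec s t)
      rw [← elim_elim] at this
      simp only [Finsupp.sub_apply, alphaVec_apply] at this
      rw [bracketGen, this, hm, hm]; rfl

theorem bracket_def (x y : InsElim) : ⁅x, y⁆ = bracketLin x y := rfl

theorem bracket_basis (a b : InsElimGen) : ⁅stdBasis a, stdBasis b⁆ = bracketGen a b := by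
  rw [bracket_def, bracketLin, Module.Basis.constr_basis, Module.Basis.constr_basis]

theorem basis_induction {p : InsElim → Prop} (h0 : p 0) (ha : ∀ x y, p x → p y → p (x + y))
    (hs : ∀ (a : ℂ) x, p x → p (a • x)) (hb : ∀ a, p (stdBasis a)) (x : InsElim) : p x := by
  have hx : x ∈ Submodule.span ℂ (Set.range stdBasis) := by simp [stdBasis.span_eq]
  induction hx using Submodule.span_induction with
  | mem x h => obtain ⟨a, rfl⟩ := h; exact hb a
  | zero => exact h0
  | add x y _ _ hx hy => exact ha x y hx hy
  | smul a x _ hx => exact hs a x hx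

theorem action_bracket (x y : InsElim) (m : Comb) :
    action ⁅x, y⁆ m = action x (action y m) - action y (action x m) := by
  rw [bracket_def]
  induction x using basis_induction with
  | h0 => simp
  | ha x x' hx hx' => simp only [map_add, LinearMap.add_apply, hx, hx']; abel
  | hs a x hx => simp only [map_smul, LinearMap.smul_apply, hx, smul_sub]
  | hb a => induction y using basis_induction with
    | h0 => simp
    | ha x x' hx hx' => simp only [map_add, LinearMap.add_apply, hx, hx']; abel
    | hs a x hx => simp only [map_smul, LinearMap.smul_apply, hx, smul_sub]
    | hb b => rw [← bracket_def, bracket_basis, action_bracketGen]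

/-- The one-vertex tree. -/
def dot : RTree := node 0 Fin.elim0

/-- The tree with a single component `t`. -/
noncomputable def stem (t : TreeClass) : RTree := node 1 fun _ => t.rep

theorem mk_stem_injective : Function.Injective fun t => mk (stem t) := by
  intro s t h
  obtain ⟨σ, hσ⟩ := exists_of_isIso_node (mk_eq.1 h)
  rw [← mk_rep s, ← mk_rep t]
  exact mk_eq.2 (hσ 0)

theorem mk_stem_ne (t : TreeClass) : mk (stem t) ≠ mk dot := by
  intro h
  obtain ⟨σ, -⟩ := exists_of_isIso_node (mk_eq.1 h)
  exact (σ 0).elim0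

theorem ins_dot (t : TreeClass) :
    ins t (Finsupp.single (mk dot) 1) = Finsupp.single (mk (stem t)) 1 := by
  rw [ins_mk, dot, insRaw_node, stem, ← nodeMap_prod]
  simp [mk_rep]

theorem deg_dot : deg (Finsupp.single (mk dot) 1) = Finsupp.single (mk dot) 1 := by
  rw [deg_single, size_mk, dot, card_node]
  simp

theorem elim_dot (t : TreeClass) : TreeClass.elim t (Finsupp.single (mk dot) 1) = 0 := by
  rw [elim_mk, dot, elimRaw_node]
  simp

open Classical in
theorem elim_stem (s t : TreeClass) :
    TreeClass.elim s (Finsupp.single (mk (stem t)) 1) (mk dot) = if t = s then 1 else 0 := by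
  have h : (slot (fun _ : Fin 1 => t.rep) 0 (elimRaw s t.rep)) (mk dot) = 0 := by
    rw [← Finsupp.sum_single (elimRaw s t.rep), Finsupp.sum, map_sum, Finsupp.finsetSum_apply]
    refine Finset.sum_eq_zero fun r _ => ?_
    rw [← mul_one (elimRaw s t.rep r), ← smul_eq_mul, ← Finsupp.smul_single, map_smul, ← mk_rep r,
      slot_single, Finsupp.smul_apply, Finsupp.single_eq_of_ne, smul_zero]
    intro h
    obtain ⟨σ, -⟩ := exists_of_isIso_node (mk_eq.1 h)
    exact (σ.symm 0).elim0
  rw [elim_mk, stem, elimRaw_node, Fin.sum_univ_one, Finsupp.add_apply, h, add_zero, mk_rep]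
  split_ifs
  · have h1 := nodeMap_prod (Fin.elim0 : Fin 0 → RTree)
    rw [Fin.prod_univ_zero] at h1
    rw [show (Finset.univ : Finset (Fin 1)).erase 0 = ∅ from rfl, Finset.prod_empty, h1, dot,
      Finsupp.single_eq_same]
  · rfl

theorem coeff_of_basis (g : InsElimGen) (m : Comb) (q : TreeClass)
    (h : ∀ a, action (stdBasis a) m q = stdBasis.repr (stdBasis a) g) (x : InsElim) :
    action x m q = stdBasis.repr x g := by
  induction x using basis_induction with
  | h0 => simp
  | ha x y hx hy =>
    rw [map_add, map_add, LinearMap.add_apply, Finsupp.add_apply, Finsupp.add_apply, hx, hy]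
  | hs a x hx => rw [map_smul, map_smul, LinearMap.smul_apply, Finsupp.smul_apply,
      Finsupp.smul_apply, hx]
  | hb a => exact h a

theorem action_injective : Function.Injective action := by
  classical
  rw [injective_iff_map_eq_zero]
  intro x hx
  have hd : action (stdBasis .d) = deg := action_d
  have hp : ∀ t, action (stdBasis (.plus t)) = ins t := action_Dp
  have hm : ∀ t, action (stdBasis (.minus t)) = TreeClass.elim t := action_Dm
  have key : ∀ g, ∃ m q, ∀ a, action (stdBasis a) m q = stdBasis.repr (stdBasis a) g := by
    intro g
    simp only [Module.Basis.repr_self, Finsupp.single_apply]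
    cases g with
    | d =>
      refine ⟨Finsupp.single (mk dot) 1, mk dot, fun a => ?_⟩
      cases a with
      | d => rw [hd, deg_dot]; simp
      | plus s => rw [hp, ins_dot, Finsupp.single_apply, if_neg (mk_stem_ne s)]; simp
      | minus s => rw [hm, elim_dot]; simp
    | plus t =>
      refine ⟨Finsupp.single (mk dot) 1, mk (stem t), fun a => ?_⟩
      cases a with
      | d => rw [hd, deg_dot, Finsupp.single_apply, if_neg (mk_stem_ne t).symm]; simp
      | plus s => rw [hp, ins_dot, Finsupp.single_apply]; simp [mk_stem_injective.eq_iff]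
      | minus s => rw [hm, elim_dot]; simp
    | minus t =>
      refine ⟨Finsupp.single (mk (stem t)) 1, mk dot, fun a => ?_⟩
      cases a with
      | d =>
        rw [hd, deg_single, Finsupp.smul_apply, Finsupp.single_apply, if_neg (mk_stem_ne t)]; simp
      | plus s =>
        rw [hp, ins_coeff]
        have : beta (mk dot) s (mk (stem t)) = 0 := by
          by_contra hne
          have h1 := size_of_beta hne
          rw [size_mk, size_mk, dot, stem, card_node, card_node, Fin.sum_univ_zero] at h1
          have := size_pos s
          omega
        rw [this]; simp
      | minus s => rw [hm, elim_stem]; simp [eq_comm]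
  apply stdBasis.repr.injective
  rw [map_zero]
  ext g
  obtain ⟨m, q, h⟩ := key g
  rw [← coeff_of_basis g m q h x, hx]
  rfl

noncomputable instance : LieRing InsElim where
  add_lie x y z := by simp only [bracket_def, map_add, LinearMap.add_apply]
  lie_add x y z := by simp only [bracket_def, map_add]
  lie_self x := action_injective (LinearMap.ext fun m => by
    rw [action_bracket, map_zero, sub_self]; rfl)
  leibniz_lie x y z := action_injective (LinearMap.ext fun m => by
    simp only [map_add, LinearMap.add_apply, action_bracket, map_sub]
    abel)

noncomputable instance : LieAlgebra ℂ InsElim where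
  lie_smul a x y := by simp only [bracket_def, map_smul]

end InsElim

/-- The automorphisms of a Lie algebra form a group under composition. -/
instance lieAutGroup {R L : Type*} [CommRing R] [LieRing L] [LieAlgebra R L] :
    Group (L ≃ₗ⁅R⁆ L) where
  mul f g := g.trans f
  one := 1
  inv f := f.symm
  mul_assoc _ _ _ := rfl
  one_mul _ := rfl
  mul_one _ := rfl
  inv_mul_cancel f := LieEquiv.ext fun x => f.symm_apply_apply x

namespace InsElim

/-- The group `Aut_ℂ(𝔤)` of automorphisms of the insertion-elimination algebra. -/
abbrev Aut : Type := InsElim ≃ₗ⁅ℂ⁆ InsElim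

/-- The linear map `τ_ζ` with `d ↦ d`, `D_t⁺ ↦ ζ^|t| D_t⁺` and `D_t⁻ ↦ ζ^(-|t|) D_t⁻`. -/
noncomputable def tau (ζ : ℂˣ) : InsElim →ₗ[ℂ] InsElim :=
  stdBasis.constr ℂ fun
    | .d => d
    | .plus t => (ζ : ℂ) ^ (TreeClass.size t : ℤ) • Dp t
    | .minus t => (ζ : ℂ) ^ (-(TreeClass.size t : ℤ)) • Dm t

/-- The linear map `σ` with `d ↦ d`, `D_t⁺ ↦ ξ_t D_t⁻` and `D_t⁻ ↦ ξ_t⁻¹ D_t⁺`. -/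
noncomputable def sigma : InsElim →ₗ[ℂ] InsElim :=
  stdBasis.constr ℂ fun
    | .d => d
    | .plus t => (TreeClass.xi t : ℂ) • Dm t
    | .minus t => (TreeClass.xi t : ℂ)⁻¹ • Dp t

/-- The map `S(x) = -x`. -/
noncomputable def antipode : InsElim →ₗ[ℂ] InsElim := -LinearMap.id

/-- The linear map `τ₀ = σ ∘ S`. -/
noncomputable def tauZero : InsElim →ₗ[ℂ] InsElim := sigma ∘ₗ antipode

end InsElim

/-!
Two facts have to be proved: `τ_ζ` and `τ₀` respect the bracket, and there are no automorphisms other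
than the `τ_ζ` and the `τ_ζ τ₀`.

For the first, the faithful representation `InsElim.action` on combinations of trees is used. In it,
`τ_ζ` is conjugation by the operator `t ↦ ζ ^ |t| t`, and `-τ₀` is the passage to the adjoint with
respect to the bilinear form with orthogonal basis the trees and `⟨t, t⟩ = ξ_t`. The adjointness
amounts to `α(s, r, t) ξ_s ξ_t = β(r, s, t) ξ_r` (`TreeClass.alpha_mul_xi`). To prove it, count
isomorphisms instead of automorphisms: the number of isomorphisms between two trees is the permanent
of the matrix of the numbers of isomorphisms between their components, and the identity follows
from the expansion of permanents by induction on the trees.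

For the second, identify combinations of trees with polynomials, a tree being the product of its
components. Then an element `x` of the algebra acts as multiplication by the linear form `x⁺` of its
positive part, up to operators that do not raise the total degree. As `x ↦ x⁺` is a cocycle, when
`x⁺ ≠ 0` the iterated brackets with `x` of a `D_t⁺` with sufficiently many components at the root
have unbounded degree, so `ad x` is not locally finite. But `ad d` is diagonalizable, hence so is
`ad (φ d)` for an automorphism `φ`, and `φ d` has no positive part (`InsElim.plusPart_aut_d`). By the
symmetry `τ₀` it has no negative part either. So `φ d` is a multiple of `d`, and it is `±d` since
the eigenvalues of `ad d` are exactly the integers.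

After composition with `τ₀` it may be assumed that `φ d = d`, so `φ` preserves the grading; after
composition with some `τ_ζ`, that `φ` is the identity in degrees `±1`. Then `φ = 1` by induction on
the degree (`InsElim.aut_Dm_of_size_eq_succ`): the difference `φ D_t⁻ - D_t⁻` commutes with all
`D_s⁺` of smaller degree, so its coefficients, as a functional on trees, vanish on everything that
arises by insertion, and such combinations span all trees with more than one vertex.
-/

/-! ### Counting isomorphisms of rooted trees -/

namespace RTree

/-- The isomorphisms of rooted trees from `s` to `t`. -/
abbrev RootIso (s t : RTree) : Type := {f : graph s ≃g graph t // f (rt s) = rt t}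

instance finite_rootIso (s t : RTree) : Finite (RootIso s t) :=
  Finite.of_injective (fun f : RootIso s t => (f.1 : Vert s → Vert t)) fun _ _ h =>
    Subtype.ext (DFunLike.coe_injective h)

/-- The number of isomorphisms of rooted trees from `s` to `t`. -/
noncomputable def isoCount (s t : RTree) : ℕ := Nat.card (RootIso s t)

/-- The map on vertices obtained from a bijection `σ` of the components and maps from each
component to its partner. -/
def nodeFun {n m : ℕ} {c : Fin n → RTree} {c' : Fin m → RTree} (σ : Fin n ≃ Fin m)
    (f : ∀ i, Vert (c i) → Vert (c' (σ i))) : Vert (node n c) → Vert (node m c')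
  | Vert.root => Vert.root
  | Vert.child i v => Vert.child (σ i) (f i v)

theorem nodeFun_bijective {n m : ℕ} {c : Fin n → RTree} {c' : Fin m → RTree} (σ : Fin n ≃ Fin m)
    {f : ∀ i, Vert (c i) → Vert (c' (σ i))} (hf : ∀ i, Function.Bijective (f i)) :
    Function.Bijective (nodeFun σ f) := by
  constructor
  · rintro (_ | ⟨i, a⟩) (_ | ⟨j, b⟩) hab
    · rfl
    · simp [nodeFun] at hab
    · simp [nodeFun] at hab
    · simp only [nodeFun, Vert.child.injEq, EmbeddingLike.apply_eq_iff_eq] at hab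
      obtain ⟨rfl, hab⟩ := hab
      rw [(hf i).1 (eq_of_heq hab)]
  · rintro (_ | ⟨j, b⟩)
    · exact ⟨Vert.root, rfl⟩
    · obtain ⟨i, rfl⟩ := σ.surjective j
      obtain ⟨a, rfl⟩ := (hf i).2 b
      exact ⟨Vert.child i a, rfl⟩

theorem adj_nodeFun {n m : ℕ} {c : Fin n → RTree} {c' : Fin m → RTree} (σ : Fin n ≃ Fin m)
    (f : ∀ i, RootIso (c i) (c' (σ i))) (a b : Vert (node n c)) :
    (graph (node m c')).Adj (nodeFun σ (fun i => (f i).1) a) (nodeFun σ (fun i => (f i).1) b) ↔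
      (graph (node n c)).Adj a b := by
  have key : ∀ b, (graph (node m c')).Adj Vert.root (nodeFun σ (fun i => (f i).1) b) ↔
      (graph (node n c)).Adj Vert.root b := by
    intro b
    rw [adj_root, adj_root]
    cases b with
    | root => simp [nodeFun]
    | child j b =>
      simp only [nodeFun, Vert.child.injEq]
      constructor
      · rintro ⟨i, rfl, h⟩
        refine ⟨j, rfl, heq_of_eq ((f j).1.injective ?_)⟩
        rw [(f j).2]
        exact eq_of_heq h
      · rintro ⟨i, rfl, h⟩
        refine ⟨_, rfl, heq_of_eq ?_⟩
        rw [eq_of_heq h, (f j).2]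
  cases a with
  | root => exact key b
  | child i a => cases b with
    | root =>
      rw [SimpleGraph.adj_comm, SimpleGraph.adj_comm (graph (node n c))]
      exact key (Vert.child i a)
    | child j b =>
      constructor
      · intro h
        obtain rfl := σ.injective (adj_child_index h)
        exact (adj_child _ _ _).2 ((f i).1.map_adj_iff.1 ((adj_child _ _ _).1 h))
      · intro h
        obtain rfl := adj_child_index h
        exact (adj_child _ _ _).2 ((f i).1.map_adj_iff.2 ((adj_child _ _ _).1 h))

/-- The isomorphism of rooted trees obtained from a bijection of the components and isomorphisms
between corresponding components. -/
noncomputable def nodeIso {n m : ℕ} {c : Fin n → RTree} {c' : Fin m → RTree}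
    (p : (σ : Fin n ≃ Fin m) × ∀ i, RootIso (c i) (c' (σ i))) :
    RootIso (node n c) (node m c') :=
  ⟨⟨Equiv.ofBijective (nodeFun p.1 fun i => (p.2 i).1)
    (nodeFun_bijective p.1 fun i => (p.2 i).1.bijective),
    fun {a b} => adj_nodeFun p.1 p.2 a b⟩, rfl⟩

theorem nodeIso_child {n m : ℕ} {c : Fin n → RTree} {c' : Fin m → RTree}
    (p : (σ : Fin n ≃ Fin m) × ∀ i, RootIso (c i) (c' (σ i))) (i : Fin n) (v : Vert (c i)) :
    (nodeIso p).1 (Vert.child i v) = Vert.child (p.1 i) ((p.2 i).1 v) := rfl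

theorem nodeIso_injective {n m : ℕ} {c : Fin n → RTree} {c' : Fin m → RTree} :
    Function.Injective (nodeIso (c := c) (c' := c')) := by
  rintro ⟨σ, f⟩ ⟨τ, g⟩ h
  have h' : ∀ i v, (Vert.child (σ i) ((f i).1 v) : Vert (node m c')) =
      Vert.child (τ i) ((g i).1 v) := fun i v => by
    rw [← nodeIso_child ⟨σ, f⟩, ← nodeIso_child ⟨τ, g⟩, h]
  obtain rfl : σ = τ := Equiv.ext fun i => by
    have := h' i (rt _)
    simp only [Vert.child.injEq] at this
    exact this.1
  congr 1
  funext i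
  refine Subtype.ext (DFunLike.ext _ _ fun v => ?_)
  simpa using h' i v

theorem nodeIso_surjective {n m : ℕ} {c : Fin n → RTree} {c' : Fin m → RTree} :
    Function.Surjective (nodeIso (c := c) (c' := c')) := by
  rintro ⟨f, hf⟩
  change f Vert.root = Vert.root at hf
  have hf' : f.symm Vert.root = Vert.root := by rw [← hf]; exact f.symm_apply_apply _
  have h1 : ∀ i, ∃ j, f (Vert.child i (rt (c i))) = Vert.child j (rt (c' j)) := by
    intro i
    rw [← adj_root, ← hf]
    exact f.map_adj_iff.2 ((adj_root _).2 ⟨i, rfl⟩)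
  have h2 : ∀ j, ∃ i, f.symm (Vert.child j (rt (c' j))) = Vert.child i (rt (c i)) := by
    intro i
    rw [← adj_root, ← hf']
    exact f.symm.map_adj_iff.2 ((adj_root _).2 ⟨i, rfl⟩)
  choose σ hσ using h1
  choose τ hτ using h2
  have e1 : ∀ i, τ (σ i) = i := by
    intro i
    have := hτ (σ i)
    rw [← hσ, RelIso.symm_apply_apply] at this
    simp only [Vert.child.injEq] at this
    exact this.1.symm
  have e2 : ∀ i, σ (τ i) = i := by
    intro i
    have := hσ (τ i)
    rw [← hτ, RelIso.apply_symm_apply] at this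
    simp only [Vert.child.injEq] at this
    exact this.1.symm
  choose g hg using fun i => isIso_block f hf i (σ i) (hσ i)
  have hbij : ∀ i, Function.Bijective (g i) := by
    refine fun i => ⟨fun a b hab => ?_, fun w => ?_⟩
    · have := f.injective ((hg i a).trans ((congrArg _ hab).trans (hg i b).symm))
      simpa using this
    · obtain ⟨v, hv⟩ := isIso_block f.symm hf' (σ i) i
        (by rw [← hσ, RelIso.symm_apply_apply]) w
      refine ⟨v, ?_⟩
      have h3 := hg i v
      rw [← hv, RelIso.apply_symm_apply] at h3
      simpa using h3.symm
  refine ⟨⟨⟨σ, τ, e1, e2⟩, fun i => ⟨⟨Equiv.ofBijective (g i) (hbij i), fun {a b} => ?_⟩, ?_⟩⟩, ?_⟩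
  · change (graph (c' (σ i))).Adj (g i a) (g i b) ↔ _
    rw [← adj_child, ← hg, ← hg, f.map_adj_iff, adj_child]
  · change g i _ = rt (c' (σ i))
    have h3 := hg i (rt (c i))
    rw [hσ] at h3
    simpa using h3.symm
  · refine Subtype.ext (DFunLike.ext _ _ fun v => ?_)
    cases v with
    | root => exact hf.symm
    | child i v => exact (hg i v).symm

/-- An isomorphism permutes the components, so the number of isomorphisms is a permanent. -/
theorem isoCount_node {n m : ℕ} (c : Fin n → RTree) (c' : Fin m → RTree) :
    isoCount (node n c) (node m c') = ∑ σ : Fin n ≃ Fin m, ∏ i, isoCount (c i) (c' (σ i)) := by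
  rw [isoCount, ← Nat.card_congr (Equiv.ofBijective _ ⟨nodeIso_injective, nodeIso_surjective⟩),
    Nat.card_sigma]
  simp only [Nat.card_pi]
  rfl

/-- A bijection `Fin (n + 1) ≃ Fin (m + 1)` is determined by the preimage of `0` and the bijection
between the remaining elements. -/
def insertZero {n m : ℕ} (p : Fin (n + 1) × (Fin n ≃ Fin m)) : Fin (n + 1) ≃ Fin (m + 1) :=
  (finSuccEquiv' p.1).trans ((Equiv.optionCongr p.2).trans (finSuccEquiv' 0).symm)

theorem insertZero_self {n m : ℕ} (p : Fin (n + 1) × (Fin n ≃ Fin m)) :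
    insertZero p p.1 = 0 := by
  simp [insertZero]

theorem insertZero_succAbove {n m : ℕ} (p : Fin (n + 1) × (Fin n ≃ Fin m)) (j : Fin n) :
    insertZero p (p.1.succAbove j) = (p.2 j).succ := by
  simp [insertZero]

theorem insertZero_bijective {n m : ℕ} : Function.Bijective (insertZero (n := n) (m := m)) := by
  constructor
  · rintro ⟨i, σ⟩ ⟨j, τ⟩ h
    obtain rfl : i = j := by
      have h1 := insertZero_self (i, σ)
      rw [h, ← insertZero_self (j, τ)] at h1
      exact (insertZero (j, τ)).injective h1
    congr 1
    refine Equiv.ext fun k => Fin.succ_injective _ ?_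
    rw [← insertZero_succAbove (i, σ), h, insertZero_succAbove (i, τ)]
  · intro σ
    have h : ∀ j : Fin n, ∃ k : Fin m, σ ((σ.symm 0).succAbove j) = k.succ := fun j => by
      obtain ⟨k, hk⟩ := Fin.exists_succ_eq.2
        (fun h : σ ((σ.symm 0).succAbove j) = 0 => Fin.succAbove_ne _ j (σ.eq_symm_apply.2 h))
      exact ⟨k, hk.symm⟩
    choose f hf using h
    have hb : Function.Bijective f := by
      constructor
      · intro a b hab
        have := (hf a).trans ((congrArg Fin.succ hab).trans (hf b).symm)
        exact Fin.succAbove_right_injective (σ.injective this)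
      · intro k
        obtain ⟨j, hj⟩ := Fin.exists_succAbove_eq (x := σ.symm k.succ) (y := σ.symm 0)
          (fun h => Fin.succ_ne_zero k (σ.symm.injective h))
        refine ⟨j, Fin.succ_injective _ ?_⟩
        rw [← hf, hj, Equiv.apply_symm_apply]
    refine ⟨(σ.symm 0, Equiv.ofBijective f hb), Equiv.ext fun i => ?_⟩
    rcases Fin.eq_self_or_eq_succAbove (σ.symm 0) i with rfl | ⟨j, rfl⟩
    · rw [insertZero_self (σ.symm 0, Equiv.ofBijective f hb), Equiv.apply_symm_apply]
    · rw [insertZero_succAbove (σ.symm 0, Equiv.ofBijective f hb), hf]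
      rfl

/-- Expansion of the permanent along the added component. -/
theorem isoCount_node_cons {n m : ℕ} (c : Fin n → RTree) (c' : Fin m → RTree) (s : RTree) :
    isoCount (node n c) (node (m + 1) (Fin.cons s c')) =
      ∑ i, isoCount (c i) s * isoCount (eraseChild c i) (node m c') := by
  rw [isoCount_node]
  cases n with
  | zero =>
    rw [Fin.sum_univ_zero]
    exact Finset.sum_eq_zero fun σ _ => (σ.symm 0).elim0
  | succ n =>
    rw [← (Equiv.ofBijective _ insertZero_bijective).sum_comp, Fintype.sum_prod_type]
    refine Finset.sum_congr rfl fun i _ => ?_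
    rw [eraseChild, isoCount_node, Finset.mul_sum]
    refine Finset.sum_congr rfl fun σ _ => ?_
    rw [Equiv.ofBijective_apply, Fin.prod_univ_succAbove _ i, insertZero_self (i, σ)]
    simp only [insertZero_succAbove (i, σ), Fin.cons_zero, Fin.cons_succ]

theorem prod_isoCount_update_right {n m : ℕ} (c : Fin n → RTree) (c' : Fin m → RTree)
    (σ : Fin n ≃ Fin m) (i : Fin n) (t : RTree) :
    ∏ k, isoCount (c k) (Function.update c' (σ i) t (σ k)) =
      isoCount (c i) t * ∏ k ∈ Finset.univ.erase i, isoCount (c k) (c' (σ k)) := by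
  rw [← Finset.mul_prod_erase _ _ (Finset.mem_univ i), Function.update_self]
  congr 1
  refine Finset.prod_congr rfl fun k hk => ?_
  rw [Function.update_of_ne (fun h => Finset.ne_of_mem_erase hk (σ.injective h))]

theorem prod_isoCount_update_left {n m : ℕ} (c : Fin n → RTree) (c' : Fin m → RTree)
    (σ : Fin n ≃ Fin m) (i : Fin n) (t : RTree) :
    ∏ k, isoCount (Function.update c i t k) (c' (σ k)) =
      isoCount t (c' (σ i)) * ∏ k ∈ Finset.univ.erase i, isoCount (c k) (c' (σ k)) := by
  rw [← Finset.mul_prod_erase _ _ (Finset.mem_univ i), Function.update_self]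
  congr 1
  refine Finset.prod_congr rfl fun k hk => ?_
  rw [Function.update_of_ne (Finset.ne_of_mem_erase hk)]

/-- Cutting `r` into pieces isomorphic to `s` and `t` is the same as identifying `r` with the
result of joining `s` to `t` at some vertex. -/
theorem sum_isoCount_cut (r t s : RTree) :
    ∑ e : Edge r, isoCount (pruned r e) s * isoCount (trunk r e) t =
      ∑ v : Vert t, isoCount r (graft t v s) := by
  induction r generalizing t with
  | node n c ih =>
    cases t with
    | node m c' =>
      rw [sum_edge, sum_vert, Finset.sum_add_distrib]
      simp only [pruned, trunk, graft]
      rw [isoCount_node_cons]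
      congr 1
      simp only [isoCount_node, prod_isoCount_update_left]
      -- Insertion into the `j`-th component of `t` matches cutting the component of `r` that
      -- corresponds to it under `σ`.
      have h : ∀ j : Fin m, ∑ v : Vert (c' j), ∑ σ : Fin n ≃ Fin m,
          ∏ i, isoCount (c i) (Function.update c' j (graft (c' j) v s) (σ i)) =
          ∑ σ : Fin n ≃ Fin m, ∑ e : Edge (c (σ.symm j)),
            isoCount (pruned (c (σ.symm j)) e) s * (isoCount (trunk (c (σ.symm j)) e) (c' j) *
            ∏ k ∈ Finset.univ.erase (σ.symm j), isoCount (c k) (c' (σ k))) := by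
        intro j
        rw [Finset.sum_comm]
        refine Finset.sum_congr rfl fun σ _ => ?_
        obtain ⟨i, rfl⟩ := σ.surjective j
        rw [Equiv.symm_apply_apply]
        simp only [prod_isoCount_update_right, ← mul_assoc]
        rw [← Finset.sum_mul, ← Finset.sum_mul, ih]
      simp only [h]
      rw [Finset.sum_comm (s := (Finset.univ : Finset (Fin m)))]
      simp only [Finset.mul_sum]
      have h' : ∀ i : Fin n, ∑ e : Edge (c i), ∑ σ : Fin n ≃ Fin m,
          isoCount (pruned (c i) e) s * (isoCount (trunk (c i) e) (c' (σ i)) *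
            ∏ k ∈ Finset.univ.erase i, isoCount (c k) (c' (σ k))) = ∑ σ : Fin n ≃ Fin m,
          ∑ e : Edge (c i), isoCount (pruned (c i) e) s * (isoCount (trunk (c i) e) (c' (σ i)) *
            ∏ k ∈ Finset.univ.erase i, isoCount (c k) (c' (σ k))) := fun i => Finset.sum_comm
      simp only [h']
      rw [Finset.sum_comm]
      refine Finset.sum_congr rfl fun σ _ => ?_
      rw [← σ.sum_comp]
      exact Finset.sum_congr rfl fun i _ => by rw [Equiv.symm_apply_apply]

theorem isoCount_congr {s s' t t' : RTree} (h : IsIso s s') (h' : IsIso t t') :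
    isoCount s t = isoCount s' t' := by
  obtain ⟨f, hf⟩ := h
  obtain ⟨g, hg⟩ := h'
  have hf' : f.symm (rt s') = rt s := by rw [← hf]; exact f.symm_apply_apply _
  have hg' : g.symm (rt t') = rt t := by rw [← hg]; exact g.symm_apply_apply _
  refine Nat.card_congr ⟨fun k => ⟨(f.symm.trans k.1).trans g, ?_⟩,
    fun k => ⟨(f.trans k.1).trans g.symm, ?_⟩, fun k => ?_, fun k => ?_⟩
  · simp only [RelIso.trans_apply, hf', k.2, hg]
  · simp only [RelIso.trans_apply, hf, k.2, hg']
  · refine Subtype.ext (DFunLike.ext _ _ fun v => ?_)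
    simp only [RelIso.trans_apply, RelIso.symm_apply_apply]
  · refine Subtype.ext (DFunLike.ext _ _ fun v => ?_)
    simp only [RelIso.trans_apply, RelIso.apply_symm_apply]

end RTree

namespace TreeClass

open RTree

open Classical in
theorem isoCount_eq (s t : RTree) : isoCount s t = if mk s = mk t then xi (mk s) else 0 := by
  split_ifs with h
  · have hs := mk_eq.1 (mk_rep (mk s))
    exact (isoCount_congr hs (hs.trans (mk_eq.1 h))).symm
  · rw [isoCount, Nat.card_eq_zero]
    exact Or.inl ⟨fun f => h (mk_eq.2 ⟨f.1, f.2⟩)⟩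

theorem xi_pos (t : TreeClass) : 0 < xi t :=
  Nat.card_pos_iff.2 ⟨⟨⟨SimpleGraph.Iso.refl, rfl⟩⟩, finite_rootIso _ _⟩

/-- The symmetry factors relate cutting and grafting: both sides count the ways to identify `r`
with a tree obtained by joining `s` to a vertex of `t`. -/
theorem alpha_mul_xi (s r t : TreeClass) : alpha s r t * (xi s * xi t) = beta r s t * xi r := by
  classical
  have h := sum_isoCount_cut r.rep t.rep s.rep
  have h1 : ∀ e : Edge r.rep,
      isoCount (pruned r.rep e) s.rep * isoCount (trunk r.rep e) t.rep =
      if mk (trunk r.rep e) = t ∧ mk (pruned r.rep e) = s then xi s * xi t else 0 := by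
    intro e
    rw [isoCount_eq, isoCount_eq, mk_rep, mk_rep]
    split_ifs <;> simp_all
  have h2 : ∀ v : Vert t.rep, isoCount r.rep (graft t.rep v s.rep) =
      if r = mk (graft t.rep v s.rep) then xi r else 0 := by
    intro v
    rw [isoCount_eq, mk_rep]
  simp only [h1, h2] at h
  rw [← Finset.sum_filter, ← Finset.sum_filter, Finset.sum_const, Finset.sum_const, smul_eq_mul,
    smul_eq_mul] at h
  rw [alpha, beta, Nat.card_eq_fintype_card, Nat.card_eq_fintype_card, Fintype.card_subtype,
    Fintype.card_subtype, h]

end TreeClass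

/-! ### Values on the standard basis -/

namespace InsElim

open TreeClass RTree

theorem tau_d (ζ : ℂˣ) : tau ζ d = d := stdBasis.constr_basis ℂ _ _

theorem tau_Dp (ζ : ℂˣ) (t : TreeClass) : tau ζ (Dp t) = (ζ : ℂ) ^ (size t : ℤ) • Dp t :=
  stdBasis.constr_basis ℂ _ _

theorem tau_Dm (ζ : ℂˣ) (t : TreeClass) : tau ζ (Dm t) = (ζ : ℂ) ^ (-(size t : ℤ)) • Dm t :=
  stdBasis.constr_basis ℂ _ _

theorem tauZero_d : tauZero d = -d := by
  have : sigma d = d := stdBasis.constr_basis ℂ _ _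
  simp [tauZero, antipode, this]

theorem tauZero_Dp (t : TreeClass) : tauZero (Dp t) = -((xi t : ℂ) • Dm t) := by
  have : sigma (Dp t) = (xi t : ℂ) • Dm t := stdBasis.constr_basis ℂ _ _
  simp [tauZero, antipode, this]

theorem tauZero_Dm (t : TreeClass) : tauZero (Dm t) = -((xi t : ℂ)⁻¹ • Dp t) := by
  have : sigma (Dm t) = (xi t : ℂ)⁻¹ • Dp t := stdBasis.constr_basis ℂ _ _
  simp [tauZero, antipode, this]

theorem xi_ne_zero (t : TreeClass) : xi t ≠ 0 := (xi_pos t).ne'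

theorem xi_cast_ne_zero (t : TreeClass) : (xi t : ℂ) ≠ 0 := Nat.cast_ne_zero.2 (xi_ne_zero t)

theorem gen_induction {p : InsElim → Prop} (h0 : p 0) (ha : ∀ x y, p x → p y → p (x + y))
    (hs : ∀ (a : ℂ) x, p x → p (a • x)) (hd : p d) (hp : ∀ t, p (Dp t)) (hm : ∀ t, p (Dm t))
    (x : InsElim) : p x := by
  refine basis_induction h0 ha hs (fun a => ?_) x
  cases a with
  | d => exact hd
  | plus t => exact hp t
  | minus t => exact hm t

theorem linearMap_ext {M : Type*} [AddCommGroup M] [Module ℂ M] {f g : InsElim →ₗ[ℂ] M}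
    (hd : f d = g d) (hp : ∀ t, f (Dp t) = g (Dp t)) (hm : ∀ t, f (Dm t) = g (Dm t)) : f = g :=
  stdBasis.ext fun a => by
    cases a with
    | d => exact hd
    | plus t => exact hp t
    | minus t => exact hm t

/-! ### The automorphisms `τ_ζ` -/

/-- The operator multiplying each tree `t` by `ζ ^ |t|`. -/
noncomputable def scale (ζ : ℂˣ) : Module.End ℂ Comb :=
  Finsupp.linearCombination ℂ fun t => Finsupp.single t ((ζ : ℂ) ^ (size t : ℤ))

theorem scale_single (ζ : ℂˣ) (t : TreeClass) :
    scale ζ (Finsupp.single t 1) = (ζ : ℂ) ^ (size t : ℤ) • Finsupp.single t 1 := by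
  simp [scale]

theorem scale_apply (ζ : ℂˣ) (m : Comb) (r : TreeClass) :
    scale ζ m r = (ζ : ℂ) ^ (size r : ℤ) * m r := by
  classical
  induction m using Finsupp.induction_linear with
  | zero => simp
  | add f g hf hg => rw [map_add, Finsupp.add_apply, hf, hg, Finsupp.add_apply, mul_add]
  | single t a =>
    rw [← mul_one a, ← smul_eq_mul, ← Finsupp.smul_single, map_smul, scale_single]
    simp only [Finsupp.smul_apply, Finsupp.single_apply, smul_eq_mul]
    split_ifs with h
    · rw [h]; ring
    · ring

theorem scale_surjective (ζ : ℂˣ) : Function.Surjective (scale ζ) := by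
  intro m
  refine ⟨scale ζ⁻¹ m, Finsupp.ext fun r => ?_⟩
  rw [scale_apply, scale_apply, ← mul_assoc, ← mul_zpow]
  simp

/-- `τ_ζ` is conjugation by `scale ζ` in the representation on combinations of trees. -/
theorem action_tau (ζ : ℂˣ) (x : InsElim) (m : Comb) :
    action (tau ζ x) (scale ζ m) = scale ζ (action x m) := by
  have hζ : (ζ : ℂ) ≠ 0 := ζ.ne_zero
  have key : ∀ {x : InsElim}, (∀ t, action (tau ζ x) (scale ζ (Finsupp.single t 1)) =
      scale ζ (action x (Finsupp.single t 1))) → action (tau ζ x) * scale ζ =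
        scale ζ * action x := by
    intro x h
    ext t : 2
    exact h t
  suffices h : action (tau ζ x) * scale ζ = scale ζ * action x from LinearMap.congr_fun h m
  induction x using gen_induction with
  | h0 => simp
  | ha x y hx hy => simp only [map_add, add_mul, mul_add, hx, hy]
  | hs a x hx => simp only [map_smul, smul_mul_assoc, mul_smul_comm, hx]
  | hd =>
    refine key fun t => ?_
    rw [tau_d, action_d, scale_single, map_smul, deg_single, map_smul, scale_single, smul_comm]
  | hp s =>
    refine key fun t => Finsupp.ext fun r => ?_
    rw [tau_Dp, map_smul, action_Dp, scale_single, map_smul, scale_apply]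
    simp only [LinearMap.smul_apply, Finsupp.smul_apply, smul_eq_mul, ins_coeff]
    by_cases h : beta r s t = 0
    · simp [h]
    · rw [size_of_beta h]
      push_cast
      rw [zpow_add₀ hζ]
      ring
  | hm s =>
    refine key fun t => Finsupp.ext fun r => ?_
    rw [tau_Dm, map_smul, action_Dm, scale_single, map_smul, scale_apply]
    simp only [LinearMap.smul_apply, Finsupp.smul_apply, smul_eq_mul, elim_coeff]
    by_cases h : alpha s t r = 0
    · simp [h]
    · rw [size_of_alpha h]
      push_cast
      rw [zpow_add₀ hζ, zpow_neg]
      have := zpow_ne_zero (size s : ℤ) hζ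
      field_simp

theorem tau_lie (ζ : ℂˣ) (x y : InsElim) : tau ζ ⁅x, y⁆ = ⁅tau ζ x, tau ζ y⁆ := by
  refine action_injective (LinearMap.ext fun m => ?_)
  obtain ⟨m, rfl⟩ := scale_surjective ζ m
  rw [action_tau, action_bracket, action_bracket]
  simp only [action_tau, map_sub]

theorem tau_tau (ζ η : ℂˣ) (x : InsElim) : tau ζ (tau η x) = tau (ζ * η) x := by
  suffices h : tau ζ ∘ₗ tau η = tau (ζ * η) from LinearMap.congr_fun h x
  refine linearMap_ext ?_ (fun t => ?_) (fun t => ?_)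
  · simp only [LinearMap.comp_apply, tau_d]
  · simp only [LinearMap.comp_apply, tau_Dp, map_smul, smul_smul, Units.val_mul, mul_zpow]
    rw [mul_comm]
  · simp only [LinearMap.comp_apply, tau_Dm, map_smul, smul_smul, Units.val_mul, mul_zpow]
    rw [mul_comm]

theorem tau_one (x : InsElim) : tau 1 x = x := by
  suffices h : tau 1 = LinearMap.id from LinearMap.congr_fun h x
  refine linearMap_ext ?_ (fun t => ?_) (fun t => ?_)
  · simp [tau_d]
  · simp [tau_Dp]
  · simp [tau_Dm]

/-! ### The automorphism `τ₀` -/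

theorem tauZero_tauZero (x : InsElim) : tauZero (tauZero x) = x := by
  suffices h : tauZero ∘ₗ tauZero = LinearMap.id from LinearMap.congr_fun h x
  refine linearMap_ext ?_ (fun t => ?_) (fun t => ?_)
  · simp [tauZero_d]
  · simp [tauZero_Dp, tauZero_Dm, smul_smul, xi_ne_zero]
  · simp [tauZero_Dp, tauZero_Dm, smul_smul, xi_ne_zero]

/-- The symmetric bilinear form for which the trees are orthogonal and `⟨t, t⟩ = ξ_t`. -/
noncomputable def form : Comb →ₗ[ℂ] Comb →ₗ[ℂ] ℂ :=
  Finsupp.linearCombination ℂ fun t => (xi t : ℂ) • Finsupp.lapply t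

theorem form_single (t : TreeClass) (m : Comb) :
    form (Finsupp.single t 1) m = xi t * m t := by
  simp [form]

theorem form_single_right (m : Comb) (t : TreeClass) :
    form m (Finsupp.single t 1) = xi t * m t := by
  classical
  induction m using Finsupp.induction_linear with
  | zero => simp
  | add f g hf hg => rw [map_add, LinearMap.add_apply, hf, hg, Finsupp.add_apply, mul_add]
  | single s a =>
    rw [← mul_one a, ← smul_eq_mul, ← Finsupp.smul_single, map_smul, LinearMap.smul_apply,
      form_single]
    simp only [Finsupp.smul_apply, Finsupp.single_apply, smul_eq_mul, eq_comm (a := t)]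
    split_ifs with h
    · rw [h]; ring
    · ring

theorem form_right_separating {m m' : Comb} (h : ∀ n, form m n = form m' n) : m = m' := by
  ext t
  have := h (Finsupp.single t 1)
  rw [form_single_right, form_single_right] at this
  exact mul_left_cancel₀ (xi_cast_ne_zero t) this

/-- `-τ₀` takes adjoints with respect to `form`: by `TreeClass.alpha_mul_xi`, elimination of `s`
is adjoint to insertion of `s` up to the factor `ξ_s`. -/
theorem form_action_tauZero (x : InsElim) (m m' : Comb) :
    form (action (tauZero x) m) m' = -form m (action x m') := by
  have key : ∀ {x : InsElim}, (∀ t r, form (action (tauZero x) (Finsupp.single t 1))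
      (Finsupp.single r 1) = -form (Finsupp.single t 1) (action x (Finsupp.single r 1))) →
      ∀ m m', form (action (tauZero x) m) m' = -form m (action x m') := by
    intro x h m m'
    suffices e : form ∘ₗ action (tauZero x) = -(form.compl₂ (action x)) from
      LinearMap.congr_fun₂ e m m'
    ext t r
    exact h t r
  have hab : ∀ s r t, (alpha s r t : ℂ) * (xi s * xi t) = beta r s t * xi r := fun s r t => by
    exact_mod_cast alpha_mul_xi s r t
  induction x using gen_induction generalizing m m' with
  | h0 => simp
  | ha x y hx hy => simp only [map_add, LinearMap.add_apply, hx, hy, neg_add]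
  | hs a x hx => simp only [map_smul, LinearMap.smul_apply, hx, smul_neg]
  | hd =>
    refine key (fun t r => ?_) m m'
    rw [tauZero_d, map_neg, action_d, LinearMap.neg_apply, map_neg, LinearMap.neg_apply,
      deg_single, deg_single, map_smul, map_smul, LinearMap.smul_apply, form_single]
    by_cases h : t = r
    · rw [h]
    · simp [Ne.symm h]
  | hp s =>
    refine key (fun t r => ?_) m m'
    rw [tauZero_Dp, map_neg, map_smul, action_Dm, action_Dp, LinearMap.neg_apply, map_neg,
      LinearMap.neg_apply, LinearMap.smul_apply, map_smul, LinearMap.smul_apply,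
      form_single_right, form_single, elim_coeff, ins_coeff, smul_eq_mul]
    linear_combination -hab s t r
  | hm s =>
    refine key (fun t r => ?_) m m'
    rw [tauZero_Dm, map_neg, map_smul, action_Dm, action_Dp, LinearMap.neg_apply, map_neg,
      LinearMap.neg_apply, LinearMap.smul_apply, map_smul, LinearMap.smul_apply,
      form_single_right, form_single, elim_coeff, ins_coeff, smul_eq_mul]
    have := xi_cast_ne_zero s
    field_simp
    linear_combination hab s r t

theorem tauZero_lie (x y : InsElim) : tauZero ⁅x, y⁆ = ⁅tauZero x, tauZero y⁆ := by
  refine action_injective (LinearMap.ext fun m => form_right_separating fun n => ?_)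
  rw [form_action_tauZero, action_bracket, action_bracket]
  simp only [map_sub, LinearMap.sub_apply, form_action_tauZero]
  ring

/-! ### Relations in the automorphism group -/

/-- `τ_ζ` as an automorphism. -/
noncomputable def tauAut (ζ : ℂˣ) : Aut where
  toLinearMap := tau ζ
  map_lie' := tau_lie ζ _ _
  invFun := tau ζ⁻¹
  left_inv x := by
    change tau ζ⁻¹ (tau ζ x) = x
    rw [tau_tau, inv_mul_cancel, tau_one]
  right_inv x := by
    change tau ζ (tau ζ⁻¹ x) = x
    rw [tau_tau, mul_inv_cancel, tau_one]

/-- `τ₀` as an automorphism. -/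
noncomputable def tauZeroAut : Aut where
  toLinearMap := tauZero
  map_lie' := tauZero_lie _ _
  invFun := tauZero
  left_inv := tauZero_tauZero
  right_inv := tauZero_tauZero

theorem tauAut_apply (ζ : ℂˣ) (x : InsElim) : tauAut ζ x = tau ζ x := rfl

theorem tauZeroAut_apply (x : InsElim) : tauZeroAut x = tauZero x := rfl

theorem mul_apply (f g : Aut) (x : InsElim) : (f * g) x = f (g x) := rfl

theorem one_apply (x : InsElim) : (1 : Aut) x = x := rfl

theorem inv_apply_self (f : Aut) (x : InsElim) : f⁻¹ (f x) = x := f.symm_apply_apply x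

theorem apply_inv_self (f : Aut) (x : InsElim) : f (f⁻¹ x) = x := f.apply_symm_apply x

theorem aut_ext {f g : Aut} (hd : f d = g d) (hp : ∀ t, f (Dp t) = g (Dp t))
    (hm : ∀ t, f (Dm t) = g (Dm t)) : f = g := by
  have : ((f : InsElim →ₗ⁅ℂ⁆ InsElim) : InsElim →ₗ[ℂ] InsElim) =
    ((g : InsElim →ₗ⁅ℂ⁆ InsElim) : InsElim →ₗ[ℂ] InsElim) := linearMap_ext hd hp hm
  exact LieEquiv.ext fun x => LinearMap.congr_fun this x

theorem tauAut_mul (ζ η : ℂˣ) : tauAut ζ * tauAut η = tauAut (ζ * η) :=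
  LieEquiv.ext fun x => tau_tau ζ η x

theorem tauAut_one : tauAut 1 = 1 := LieEquiv.ext tau_one

theorem tauZeroAut_mul_self : tauZeroAut * tauZeroAut = 1 := LieEquiv.ext tauZero_tauZero

theorem tauZeroAut_conj (ζ : ℂˣ) : tauZeroAut * tauAut ζ * tauZeroAut = tauAut ζ⁻¹ := by
  refine aut_ext ?_ (fun t => ?_) (fun t => ?_)
  · simp [mul_apply, tauAut_apply, tauZeroAut_apply, tau_d, tauZero_d]
  · simp [mul_apply, tauAut_apply, tauZeroAut_apply, tau_Dp, tau_Dm, tauZero_Dp, tauZero_Dm,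
      smul_smul, xi_ne_zero, mul_comm]
  · simp [mul_apply, tauAut_apply, tauZeroAut_apply, tau_Dp, tau_Dm, tauZero_Dp, tauZero_Dm,
      smul_smul, xi_ne_zero, mul_comm]

end InsElim

/-! ### The root degree -/

namespace TreeClass

open RTree MvPolynomial

/-- The multiset of components of a rooted tree. -/
noncomputable def children : RTree → TreeClass →₀ ℕ
  | node _ c => compts c

theorem children_congr {s t : RTree} (h : IsIso s t) : children s = children t := by
  cases s with
  | node n c => cases t with
    | node m c' =>
      obtain ⟨σ, hσ⟩ := exists_of_isIso_node h
      rw [children, children, compts, compts, ← σ.sum_comp]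
      exact Finset.sum_congr rfl fun i _ => by rw [mk_eq.2 (hσ i)]

/-- The linear map sending a rooted tree to the product of its components, inverse to
`nodeMap`. -/
noncomputable def rootPoly : Comb →ₗ[ℂ] Poly :=
  Finsupp.linearCombination ℂ fun t => monomial (children t.rep) 1

theorem rootPoly_single {n : ℕ} (c : Fin n → RTree) :
    rootPoly (Finsupp.single (mk (node n c)) 1) = ∏ i, X (mk (c i)) := by
  rw [rootPoly, Finsupp.linearCombination_single, one_smul,
    children_congr (mk_eq.1 (mk_rep (mk (node n c)))), prod_X]
  rfl

theorem rootPoly_nodeMap (F : Poly) : rootPoly (nodeMap F) = F := by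
  suffices h : rootPoly ∘ₗ nodeMap = LinearMap.id from LinearMap.congr_fun h F
  refine poly_ext fun n c => ?_
  rw [LinearMap.comp_apply, nodeMap_prod, rootPoly_single, LinearMap.id_apply]

theorem nodeMap_rootPoly (m : Comb) : nodeMap (rootPoly m) = m := by
  suffices h : nodeMap ∘ₗ rootPoly = LinearMap.id from LinearMap.congr_fun h m
  ext t : 2
  refine ind (p := fun t => nodeMap (rootPoly (Finsupp.single t 1)) = Finsupp.single t 1)
    (fun t => ?_) t
  cases t with
  | node n c => rw [rootPoly_single, nodeMap_prod]

theorem rootPoly_ne_zero {m : Comb} (h : m ≠ 0) : rootPoly m ≠ 0 := fun h' =>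
  h (by rw [← nodeMap_rootPoly m, h', map_zero])

/-- The root degree of a combination of trees: the maximal number of components of the trees that
occur in it (and `0` for the combination `0`). -/
noncomputable def rootDegree (m : Comb) : ℕ := (rootPoly m).totalDegree

/-- A derivation sending the variables to polynomials of degree at most `1` does not raise the
total degree. -/
theorem totalDegree_derivation_le {ι : Type*} (f : ι → MvPolynomial ι ℂ)
    (hf : ∀ i, (f i).totalDegree ≤ 1) (F : MvPolynomial ι ℂ) :
    (mkDerivation ℂ f F).totalDegree ≤ F.totalDegree := by
  rw [F.as_sum, map_sum, ← F.as_sum]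
  refine totalDegree_finsetSum_le fun m hm => ?_
  rw [mkDerivation_monomial]
  refine (totalDegree_smul_le _ _).trans (totalDegree_finsetSum_le fun i hi => ?_)
  refine (totalDegree_mul _ _).trans ?_
  have h1 : _ ≤ (m - Finsupp.single i 1).degree :=
    totalDegree_monomial_le (R := ℂ) (m - Finsupp.single i 1) ((m i : ℕ) : ℂ)
  have h2 := hf i
  have h3 : m.degree ≤ F.totalDegree := le_totalDegree hm
  have h4 : (m - Finsupp.single i 1).degree + 1 = m.degree := by
    conv_rhs => rw [← tsub_add_cancel_of_le (Finsupp.single_le_iff.2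
      (Nat.one_le_iff_ne_zero.2 (Finsupp.mem_support_iff.1 hi)))]
    simp
  omega

theorem lin_isHomogeneous (x : Comb) : (lin x).IsHomogeneous 1 := by
  rw [lin, Finsupp.linearCombination_apply, Finsupp.sum]
  refine IsHomogeneous.sum _ _ _ fun t _ => ?_
  rw [smul_eq_C_mul]
  simpa using (isHomogeneous_C TreeClass (x t)).mul (isHomogeneous_X ℂ t)

theorem lin_ne_zero {x : Comb} (h : x ≠ 0) : lin x ≠ 0 := by
  obtain ⟨t, ht⟩ := Finsupp.ne_iff.1 h
  intro h'
  have := pderiv_lin t x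
  rw [h', map_zero] at this
  exact ht (C_eq_zero.1 this.symm)

theorem totalDegree_lin_le (x : Comb) : (lin x).totalDegree ≤ 1 :=
  (lin_isHomogeneous x).totalDegree_le

end TreeClass

namespace InsElim

open TreeClass RTree MvPolynomial

/-! ### The positive part -/

/-- The component of an element in the span of the `D_t⁺`. -/
noncomputable def plusPart : InsElim →ₗ[ℂ] Comb :=
  stdBasis.constr ℂ fun
    | .d => 0
    | .plus t => Finsupp.single t 1
    | .minus _ => 0

theorem plusPart_d : plusPart d = 0 := stdBasis.constr_basis ℂ _ _

theorem plusPart_Dp (t : TreeClass) : plusPart (Dp t) = Finsupp.single t 1 :=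
  stdBasis.constr_basis ℂ _ _

theorem plusPart_Dm (t : TreeClass) : plusPart (Dm t) = 0 := stdBasis.constr_basis ℂ _ _

theorem plusPart_finsum_Dp (w : Comb) : plusPart (∑ᶠ r, w r • Dp r) = w := by
  rw [finsum_eq, Finsupp.linearCombination_apply, Finsupp.sum, map_sum]
  simp only [map_smul, plusPart_Dp, Finsupp.smul_single, smul_eq_mul, mul_one]
  exact Finsupp.sum_single w

theorem plusPart_finsum_Dm (w : Comb) : plusPart (∑ᶠ r, w r • Dm r) = 0 := by
  rw [finsum_eq, Finsupp.linearCombination_apply, Finsupp.sum, map_sum]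
  simp only [map_smul, plusPart_Dm, smul_zero, Finset.sum_const_zero]

theorem plusPart_bracketMinusPlus (s t : TreeClass) :
    plusPart (bracketMinusPlus s t) = TreeClass.elim s (Finsupp.single t 1) := by
  rw [bracketMinusPlus]
  split_ifs with h
  · subst h
    rw [plusPart_d]
    ext r
    rw [elim_coeff]
    by_contra hne
    have := size_of_alpha (Nat.cast_ne_zero.1 (Ne.symm hne))
    have := size_pos r
    omega
  · simp only [← elim_coeff, ← betaVec_apply]
    rw [map_add, plusPart_finsum_Dp, plusPart_finsum_Dm, add_zero]

theorem plusPart_bracketGen (a b : InsElimGen) : plusPart (bracketGen a b) =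
    action (stdBasis a) (plusPart (stdBasis b)) - action (stdBasis b) (plusPart (stdBasis a)) := by
  have hd : action (stdBasis .d) = deg := action_d
  have hp : ∀ t, action (stdBasis (.plus t)) = ins t := action_Dp
  have hm : ∀ t, action (stdBasis (.minus t)) = TreeClass.elim t := action_Dm
  have h0 : plusPart (stdBasis .d) = 0 := plusPart_d
  have h1 : ∀ t, plusPart (stdBasis (.plus t)) = Finsupp.single t 1 := plusPart_Dp
  have h2 : ∀ t, plusPart (stdBasis (.minus t)) = 0 := plusPart_Dm
  cases a with
  | d => cases b with
    | d => rw [bracketGen, map_zero, sub_self]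
    | plus t => rw [bracketGen, h0, h1, hd, map_smul, plusPart_Dp, deg_single, map_zero, sub_zero]
    | minus t => rw [bracketGen, h0, h2, map_smul, plusPart_Dm]; simp
  | plus s => cases b with
    | d => rw [bracketGen, h0, h1, hd, map_neg, map_smul, plusPart_Dp, deg_single, map_zero,
        zero_sub]
    | plus t =>
      have := plusPart_finsum_Dp (ins s (Finsupp.single t 1) - ins t (Finsupp.single s 1))
      simp only [Finsupp.sub_apply, ins_coeff] at this
      rw [bracketGen, this, hp, hp, h1, h1]
    | minus t =>
      rw [bracketGen, map_neg, plusPart_bracketMinusPlus, h1, h2, hm, map_zero, zero_sub]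
  | minus s => cases b with
    | d => rw [bracketGen, h0, h2, map_neg, map_smul, plusPart_Dm]; simp
    | plus t => rw [bracketGen, plusPart_bracketMinusPlus, h1, h2, hm, map_zero, sub_zero]
    | minus t =>
      have := plusPart_finsum_Dm (alphaVec t s - alphaVec s t)
      simp only [Finsupp.sub_apply, alphaVec_apply] at this
      rw [bracketGen, this, h2, h2, map_zero, map_zero, sub_zero]

/-- `plusPart` is a cocycle with values in the combinations of trees. -/
theorem plusPart_bracket (x y : InsElim) :
    plusPart ⁅x, y⁆ = action x (plusPart y) - action y (plusPart x) := by
  rw [bracket_def]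
  induction x using basis_induction with
  | h0 => simp
  | ha x x' hx hx' => simp only [map_add, LinearMap.add_apply, hx, hx']; abel
  | hs a x hx => simp only [map_smul, LinearMap.smul_apply, hx, smul_sub]
  | hb a => induction y using basis_induction with
    | h0 => simp
    | ha x x' hx hx' => simp only [map_add, LinearMap.add_apply, hx, hx']; abel
    | hs a x hx => simp only [map_smul, LinearMap.smul_apply, hx, smul_sub]
    | hb b => rw [← bracket_def, bracket_basis, plusPart_bracketGen]

theorem totalDegree_der_le (P : Module.End ℂ Comb) (F : Poly) :
    (der P F).totalDegree ≤ F.totalDegree :=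
  totalDegree_derivation_le _ (fun _ => totalDegree_lin_le _) F

theorem totalDegree_pderiv_le (s : TreeClass) (F : Poly) :
    (pderiv s F).totalDegree ≤ F.totalDegree := by
  classical
  refine totalDegree_derivation_le _ (fun i => ?_) F
  rw [Pi.single_apply]
  split_ifs <;> simp

/-- Up to terms that do not raise the root degree, an element acts as multiplication by the linear
form of its positive part. -/
theorem totalDegree_action_sub_le (x : InsElim) (m : Comb) :
    (rootPoly (action x m) - lin (plusPart x) * rootPoly m).totalDegree ≤ rootDegree m := by
  rw [rootDegree]
  obtain ⟨F, rfl⟩ : ∃ F, nodeMap F = m := ⟨_, nodeMap_rootPoly m⟩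
  rw [rootPoly_nodeMap]
  induction x using gen_induction with
  | h0 => simp
  | ha x y hx hy =>
    refine le_trans ?_ ((totalDegree_add _ _).trans (max_le hx hy))
    simp only [map_add, LinearMap.add_apply, add_mul]
    rw [add_sub_add_comm]
  | hs a x hx =>
    refine le_trans ?_ ((totalDegree_smul_le a _).trans hx)
    simp only [map_smul, LinearMap.smul_apply, smul_mul_assoc, smul_sub]
    exact le_rfl
  | hd =>
    rw [action_d, isLift_deg F, rootPoly_nodeMap, plusPart_d, map_zero, zero_mul, sub_zero]
    exact (totalDegree_add _ _).trans (max_le le_rfl (totalDegree_der_le _ _))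
  | hp t =>
    rw [action_Dp, isLift_ins t F, rootPoly_nodeMap, plusPart_Dp, lin_single, add_sub_cancel_left]
    exact totalDegree_der_le _ _
  | hm t =>
    rw [action_Dm, isLift_elim t F, rootPoly_nodeMap, plusPart_Dm, map_zero, zero_mul, sub_zero]
    exact (totalDegree_add _ _).trans
      (max_le (totalDegree_pderiv_le _ _) (totalDegree_der_le _ _))

theorem rootDegree_action_le (x : InsElim) (m : Comb) :
    rootDegree (action x m) ≤ rootDegree m + 1 := by
  have h1 := totalDegree_action_sub_le x m
  have h2 := (totalDegree_mul (lin (plusPart x)) (rootPoly m))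
  have h3 := totalDegree_lin_le (plusPart x)
  have h4 := totalDegree_add (rootPoly (action x m) - lin (plusPart x) * rootPoly m)
    (lin (plusPart x) * rootPoly m)
  rw [sub_add_cancel] at h4
  unfold rootDegree at *
  omega

theorem rootDegree_action {x : InsElim} (hx : plusPart x ≠ 0) {m : Comb} (hm : m ≠ 0) :
    rootDegree (action x m) = rootDegree m + 1 := by
  have h1 := totalDegree_action_sub_le x m
  have h2 := totalDegree_mul_of_isDomain (lin_ne_zero hx) (rootPoly_ne_zero hm)
  rw [(lin_isHomogeneous _).totalDegree (lin_ne_zero hx)] at h2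
  have h4 := totalDegree_add_eq_left_of_totalDegree_lt (p := lin (plusPart x) * rootPoly m)
    (q := rootPoly (action x m) - lin (plusPart x) * rootPoly m)
    (by unfold rootDegree at h1; omega)
  rw [add_sub_cancel] at h4
  unfold rootDegree
  omega

theorem ne_zero_of_rootDegree {m : Comb} (h : 0 < rootDegree m) : m ≠ 0 := by
  rintro rfl
  simp [rootDegree] at h

theorem rootDegree_bracket {x y : InsElim} (hx : plusPart x ≠ 0)
    (hxy : rootDegree (plusPart x) < rootDegree (plusPart y)) :
    rootDegree (plusPart ⁅x, y⁆) = rootDegree (plusPart y) + 1 := by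
  have h1 := rootDegree_action hx (ne_zero_of_rootDegree (by omega : 0 < rootDegree (plusPart y)))
  have h2 := rootDegree_action_le y (plusPart x)
  rw [plusPart_bracket, rootDegree, map_sub, sub_eq_add_neg,
    totalDegree_add_eq_left_of_totalDegree_lt]
  · exact h1
  · rw [totalDegree_neg]
    unfold rootDegree at *
    omega

/-- Iterated brackets with an element whose positive part does not vanish have unbounded root
degree. -/
theorem rootDegree_iterate_bracket {x y : InsElim} (hx : plusPart x ≠ 0)
    (hxy : rootDegree (plusPart x) < rootDegree (plusPart y)) (k : ℕ) :
    rootDegree (plusPart ((fun z => ⁅x, z⁆)^[k] y)) = rootDegree (plusPart y) + k := by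
  induction k with
  | zero => rfl
  | succ k ih => rw [Function.iterate_succ_apply', rootDegree_bracket hx (by omega), ih, add_assoc]

theorem exists_rootDegree_eq (n : ℕ) : ∃ t : TreeClass, rootDegree (Finsupp.single t 1) = n := by
  refine ⟨mk (node n fun _ => dot), ?_⟩
  rw [rootDegree, rootPoly_single, Fin.prod_const, totalDegree_X_pow]

/-! ### The image of `d` under an automorphism -/

/-- The eigenvalue of `ad d` on a standard basis element. -/
noncomputable def weight : InsElimGen → ℤ
  | .d => 0
  | .plus t => size t
  | .minus t => -size t

theorem d_bracket_basis (a : InsElimGen) : ⁅d, stdBasis a⁆ = (weight a : ℂ) • stdBasis a := by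
  rw [d, bracket_basis]
  cases a with
  | d => simp [bracketGen, weight]
  | plus t => simp [bracketGen, weight, Dp]
  | minus t => simp [bracketGen, weight, Dm]

theorem d_bracket_Dp (t : TreeClass) : ⁅d, Dp t⁆ = (size t : ℂ) • Dp t := by
  have := d_bracket_basis (.plus t)
  rwa [weight, Int.cast_natCast] at this

theorem d_bracket_Dm (t : TreeClass) : ⁅d, Dm t⁆ = -(size t : ℂ) • Dm t := by
  have := d_bracket_basis (.minus t)
  rwa [weight, Int.cast_neg, Int.cast_natCast] at this

theorem repr_d_bracket (x : InsElim) (a : InsElimGen) :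
    stdBasis.repr ⁅d, x⁆ a = weight a * stdBasis.repr x a := by
  classical
  rw [bracket_def]
  induction x using basis_induction with
  | h0 => simp
  | ha x y hx hy => simp only [map_add, Finsupp.add_apply, hx, hy, mul_add]
  | hs c x hx => simp only [map_smul, Finsupp.smul_apply, hx, smul_eq_mul]; ring
  | hb b =>
    rw [← bracket_def, d_bracket_basis, map_smul, Module.Basis.repr_self, Finsupp.smul_apply,
      smul_eq_mul, Finsupp.single_apply]
    split_ifs with h
    · rw [h]
    · simp

/-- Eigenvectors of `ad d` are supported on the basis elements of the right weight. -/
theorem repr_eq_zero_of_weight {x : InsElim} {c : ℂ} (h : ⁅d, x⁆ = c • x) {a : InsElimGen}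
    (ha : (weight a : ℂ) ≠ c) : stdBasis.repr x a = 0 := by
  have h1 := repr_d_bracket x a
  rw [h, map_smul, Finsupp.smul_apply, smul_eq_mul] at h1
  have h2 : ((weight a : ℂ) - c) * stdBasis.repr x a = 0 := by linear_combination -h1
  exact (mul_eq_zero.1 h2).resolve_left (sub_ne_zero.2 ha)

/-- Since `ad d` is diagonalizable, so is `ad (φ d)`; hence the iterates of `ad (φ d)` do not
raise the root degree without bound, and `φ d` has no positive part. -/
theorem plusPart_aut_d (φ : Aut) : plusPart (φ d) = 0 := by
  by_contra hx
  -- Root degree one more than that of the positive part of `φ d` starts the growth of degrees.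
  obtain ⟨t, ht⟩ := exists_rootDegree_eq (rootDegree (plusPart (φ d)) + 1)
  rw [← plusPart_Dp] at ht
  set w := stdBasis.repr (φ⁻¹ (Dp t))
  -- The iterates of `ad (φ d)` on `D_t⁺` stay in the span of the finitely many `φ a` with `a` in
  -- the support of `φ⁻¹ D_t⁺`.
  have hsum : ∀ k : ℕ, (fun z => ⁅φ d, z⁆)^[k] (Dp t) =
      ∑ a ∈ w.support, (w a * (weight a : ℂ) ^ k) • φ (stdBasis a) := by
    intro k
    induction k with
    | zero =>
      have h1 : φ⁻¹ (Dp t) = ∑ a ∈ w.support, w a • stdBasis a := by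
        conv_lhs => rw [← stdBasis.linearCombination_repr (φ⁻¹ (Dp t))]
        rfl
      have h2 := congrArg φ h1
      rw [apply_inv_self, map_sum] at h2
      simpa only [Function.iterate_zero, id, pow_zero, mul_one, map_smul] using h2
    | succ k ih =>
      rw [Function.iterate_succ_apply', ih, lie_sum]
      refine Finset.sum_congr rfl fun a _ => ?_
      rw [lie_smul, ← LieEquiv.map_lie, d_bracket_basis, map_smul, smul_smul, pow_succ, mul_assoc]
  obtain ⟨N, hN⟩ : ∃ N, ∀ a ∈ w.support, (rootPoly (plusPart (φ (stdBasis a)))).totalDegree ≤ N :=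
    ⟨_, fun a ha => Finset.le_sup (f := fun a => (rootPoly (plusPart (φ (stdBasis a)))).totalDegree)
      ha⟩
  have h1 := rootDegree_iterate_bracket hx (by omega : _ < rootDegree (plusPart (Dp t))) N
  have h2 : rootDegree (plusPart ((fun z => ⁅φ d, z⁆)^[N] (Dp t))) ≤ N := by
    rw [hsum, rootDegree, map_sum, map_sum]
    refine totalDegree_finsetSum_le fun a ha => ?_
    rw [map_smul, map_smul]
    exact (totalDegree_smul_le _ _).trans (hN a ha)
  omega

theorem repr_d : stdBasis.repr d = Finsupp.single .d 1 := stdBasis.repr_self _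

theorem repr_Dp (t : TreeClass) : stdBasis.repr (Dp t) = Finsupp.single (.plus t) 1 :=
  stdBasis.repr_self _

theorem repr_Dm (t : TreeClass) : stdBasis.repr (Dm t) = Finsupp.single (.minus t) 1 :=
  stdBasis.repr_self _

theorem repr_plus_eq (x : InsElim) (t : TreeClass) :
    stdBasis.repr x (.plus t) = plusPart x t := by
  suffices h : Finsupp.lapply (.plus t) ∘ₗ stdBasis.repr.toLinearMap =
      (Finsupp.lapply t : Comb →ₗ[ℂ] ℂ) ∘ₗ plusPart from LinearMap.congr_fun h x
  classical
  refine linearMap_ext ?_ (fun s => ?_) (fun s => ?_)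
  · simp [plusPart_d, repr_d]
  · simp [plusPart_Dp, repr_Dp, Finsupp.single_apply]
  · simp [plusPart_Dm, repr_Dm]

theorem repr_minus_eq (x : InsElim) (t : TreeClass) :
    stdBasis.repr x (.minus t) = -(xi t : ℂ) * plusPart (tauZero x) t := by
  suffices h : Finsupp.lapply (.minus t) ∘ₗ stdBasis.repr.toLinearMap =
      -(xi t : ℂ) • ((Finsupp.lapply t : Comb →ₗ[ℂ] ℂ) ∘ₗ plusPart ∘ₗ tauZero) from
    LinearMap.congr_fun h x
  classical
  refine linearMap_ext ?_ (fun s => ?_) (fun s => ?_)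
  · simp [plusPart_d, repr_d, tauZero_d]
  · simp [plusPart_Dm, tauZero_Dp, repr_Dp]
  · by_cases h : s = t
    · subst h
      simp [plusPart_Dp, tauZero_Dm, repr_Dm, xi_ne_zero]
    · simp [plusPart_Dp, tauZero_Dm, repr_Dm, h]

theorem exists_aut_d_eq_smul (φ : Aut) : ∃ c : ℂ, φ d = c • d := by
  classical
  refine ⟨stdBasis.repr (φ d) .d, stdBasis.repr.injective (Finsupp.ext fun a => ?_)⟩
  rw [map_smul, d, Module.Basis.repr_self, Finsupp.smul_single, smul_eq_mul, mul_one, ← d]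
  cases a with
  | d => rw [Finsupp.single_eq_same]
  | plus t => rw [repr_plus_eq, plusPart_aut_d]; simp
  | minus t =>
    rw [repr_minus_eq, show tauZero (φ d) = (tauZeroAut * φ) d from rfl, plusPart_aut_d]; simp

/-- An automorphism maps `d` to `d` or `-d`, because the nonzero eigenvalues of `ad d` are integers
and `±1` occurs among them. -/
theorem aut_d (φ : Aut) : φ d = d ∨ φ d = -d := by
  -- If `ψ d = c • d`, then `ψ D⁺` for the one-vertex tree is an eigenvector of `ad d` with
  -- eigenvalue `1 / c`.
  have key : ∀ (ψ : Aut) (c : ℂ), ψ d = c • d → ∃ n : ℤ, 1 = c * n := by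
    intro ψ c hc
    have hne : ψ (Dp (mk dot)) ≠ 0 := fun h => by
      have h1 := congrArg (fun x => ψ⁻¹ x) h
      simp only [inv_apply_self, map_zero] at h1
      exact stdBasis.ne_zero _ h1
    have h1 : c • ⁅d, ψ (Dp (mk dot))⁆ = ψ (Dp (mk dot)) := by
      rw [← smul_lie, ← hc, ← LieEquiv.map_lie, d_bracket_Dp, size_mk, dot, card_node]
      simp
    obtain ⟨a, ha⟩ := Finsupp.ne_iff.1 ((map_ne_zero_iff _ stdBasis.repr.injective).2 hne)
    refine ⟨weight a, ?_⟩
    have h2 := DFunLike.congr_fun (congrArg stdBasis.repr h1) a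
    rw [map_smul, Finsupp.smul_apply, repr_d_bracket, smul_eq_mul, ← mul_assoc] at h2
    exact (mul_right_cancel₀ ha (by rw [h2, one_mul])).symm
  obtain ⟨c, hc⟩ := exists_aut_d_eq_smul φ
  obtain ⟨c', hc'⟩ := exists_aut_d_eq_smul φ⁻¹
  obtain ⟨n, hn⟩ := key φ c hc
  obtain ⟨n', hn'⟩ := key φ⁻¹ c' hc'
  have hcc : c' * c = 1 := by
    have h1 := inv_apply_self φ d
    rw [hc, map_smul, hc', smul_smul] at h1
    have h2 := DFunLike.congr_fun (congrArg stdBasis.repr h1) .d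
    rw [map_smul, d, Module.Basis.repr_self, Finsupp.smul_apply, Finsupp.single_eq_same,
      smul_eq_mul, mul_one, mul_comm] at h2
    exact h2
  have hnn : n * n' = 1 := by
    have : (n : ℂ) * n' = 1 := by
      linear_combination (-(n : ℂ) * n') * hcc - c' * n' * hn - hn'
    exact_mod_cast this
  rcases Int.eq_one_or_neg_one_of_mul_eq_one hnn with rfl | rfl
  · left
    rw [hc, show c = 1 by simpa using hn.symm, one_smul]
  · right
    rw [hc, show c = -1 by linear_combination (by simpa using hn : 1 = -c), neg_one_smul]

end InsElim

/-! ### Automorphisms fixing `d` -/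

namespace TreeClass

open RTree

/-- Every tree other than the one-vertex tree is a combination of trees that arise by insertion:
with one more component, the root term of the insertion is the given tree, and the remaining terms
have fewer components. -/
theorem eq_zero_of_comp_ins_eq_zero {f : Comb →ₗ[ℂ] ℂ}
    (hf : ∀ s q, f (ins s (Finsupp.single q 1)) = 0) (n : ℕ) (c : Fin (n + 1) → RTree) :
    f (Finsupp.single (mk (node (n + 1) c)) 1) = 0 := by
  induction n with
  | zero =>
    have h := hf (mk (c 0)) (mk InsElim.dot)
    rw [InsElim.ins_dot, InsElim.stem] at h
    rwa [mk_node (c' := fun _ => (mk (c 0)).rep) (Equiv.refl _) fun i => ?_]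
    rw [mk_rep, Fin.fin_one_eq_zero i]
  | succ n ih =>
    have h := hf (mk (c 0)) (mk (node (n + 1) fun i => c i.succ))
    rw [ins_mk, insRaw, sum_vert, map_add, map_sum] at h
    simp only [map_sum, graft, ih, Finset.sum_const_zero, add_zero] at h
    rwa [mk_node (c' := Fin.cons (mk (c 0)).rep fun i => c i.succ) (Equiv.refl _) fun i => ?_]
    refine Fin.cases ?_ (fun i => ?_) i
    · exact (mk_rep _).symm
    · rfl

theorem eq_mk_dot_of_size {t : TreeClass} (h : size t = 1) : t = mk InsElim.dot := by
  revert h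
  refine ind (p := fun t => size t = 1 → t = mk InsElim.dot) (fun t h => ?_) t
  cases t with
  | node n c =>
    rw [size_mk, card_node] at h
    cases n with
    | zero => exact mk_node (Equiv.refl _) fun i => i.elim0
    | succ n =>
      rw [Fin.sum_univ_succ, ← size_mk] at h
      have := size_pos (mk (c 0))
      omega

theorem size_dot : size (mk InsElim.dot) = 1 := by
  rw [size_mk, InsElim.dot, card_node, Fin.sum_univ_zero, add_zero]

end TreeClass

namespace InsElim

open TreeClass RTree

/-- The functional on combinations of trees given by the coefficients of the `D_t⁻`. -/
noncomputable def minusFun : InsElim →ₗ[ℂ] Comb →ₗ[ℂ] ℂ :=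
  stdBasis.constr ℂ fun
    | .d => 0
    | .plus _ => 0
    | .minus t => Finsupp.lapply t

theorem minusFun_d : minusFun d = 0 := stdBasis.constr_basis ℂ _ _

theorem minusFun_Dp (t : TreeClass) : minusFun (Dp t) = 0 := stdBasis.constr_basis ℂ _ _

theorem minusFun_Dm (t : TreeClass) : minusFun (Dm t) = Finsupp.lapply t :=
  stdBasis.constr_basis ℂ _ _

theorem minusFun_single (x : InsElim) (t : TreeClass) :
    minusFun x (Finsupp.single t 1) = stdBasis.repr x (.minus t) := by
  classical
  induction x using gen_induction with
  | h0 => simp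
  | ha x y hx hy => simp only [map_add, LinearMap.add_apply, Finsupp.add_apply, hx, hy]
  | hs a x hx => simp only [map_smul, LinearMap.smul_apply, Finsupp.smul_apply, hx]
  | hd => simp [minusFun_d, repr_d]
  | hp s => simp [minusFun_Dp, repr_Dp]
  | hm s => simp [minusFun_Dm, repr_Dm, Finsupp.single_apply, eq_comm]

theorem minusFun_finsum_Dp (w : Comb) : minusFun (∑ᶠ r, w r • Dp r) = 0 := by
  rw [finsum_eq, Finsupp.linearCombination_apply, Finsupp.sum, map_sum]
  simp only [map_smul, minusFun_Dp, smul_zero, Finset.sum_const_zero]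

theorem minusFun_finsum_Dm (w : Comb) (q : TreeClass) :
    minusFun (∑ᶠ r, w r • Dm r) (Finsupp.single q 1) = w q := by
  classical
  rw [finsum_eq, Finsupp.linearCombination_apply, Finsupp.sum, map_sum, LinearMap.sum_apply]
  simpa [minusFun_Dm, Finsupp.single_apply] using fun h => h.symm

theorem minusFun_bracketMinusPlus (s t q : TreeClass) :
    minusFun (bracketMinusPlus s t) (Finsupp.single q 1) = beta s t q := by
  rw [bracketMinusPlus]
  split_ifs with h
  · subst h
    rw [minusFun_d, LinearMap.zero_apply, eq_comm, Nat.cast_eq_zero]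
    by_contra hne
    have := size_of_beta hne
    have := size_pos q
    omega
  · simp only [← elim_coeff, ← betaVec_apply]
    rw [map_add, minusFun_finsum_Dp, zero_add, minusFun_finsum_Dm]

/-- On the negative part, the bracket with `D_s⁺` is the transpose of the insertion of `s`. -/
theorem minusFun_bracket_Dp (x : InsElim) (s q : TreeClass) :
    minusFun ⁅x, Dp s⁆ (Finsupp.single q 1) = minusFun x (ins s (Finsupp.single q 1)) := by
  rw [bracket_def]
  induction x using gen_induction with
  | h0 => simp
  | ha x y hx hy => simp only [map_add, LinearMap.add_apply, hx, hy]
  | hs a x hx => simp only [map_smul, LinearMap.smul_apply, hx]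
  | hd => rw [← bracket_def, d_bracket_Dp, map_smul, minusFun_Dp, minusFun_d]; simp
  | hp r =>
    have h1 := minusFun_finsum_Dp (ins r (Finsupp.single s 1) - ins s (Finsupp.single r 1))
    simp only [Finsupp.sub_apply, ins_coeff] at h1
    have h2 : ⁅Dp r, Dp s⁆ = bracketGen (.plus r) (.plus s) := bracket_basis _ _
    rw [← bracket_def, h2, bracketGen, h1, minusFun_Dp]
    rfl
  | hm r =>
    have h2 : ⁅Dm r, Dp s⁆ = bracketGen (.minus r) (.plus s) := bracket_basis _ _
    rw [← bracket_def, h2, bracketGen, minusFun_bracketMinusPlus, minusFun_Dm,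
      Finsupp.lapply_apply, ins_coeff]

/-- An automorphism fixing `d` and everything of degree at most `n ≥ 1` fixes the `D_t⁻` of degree
`n + 1`: the difference `φ D_t⁻ - D_t⁻` commutes with every `D_s⁺` of degree at most `n`, so its
coefficients vanish on all trees that arise by insertion. -/
theorem aut_Dm_of_size_eq_succ {φ : Aut} (hd : φ d = d) {n : ℕ} (hn : 1 ≤ n)
    (hp : ∀ s, size s ≤ n → φ (Dp s) = Dp s) (hm : ∀ s, size s ≤ n → φ (Dm s) = Dm s)
    {t : TreeClass} (ht : size t = n + 1) : φ (Dm t) = Dm t := by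
  have hz : ⁅d, φ (Dm t) - Dm t⁆ = -(size t : ℂ) • (φ (Dm t) - Dm t) := by
    have h1 : ⁅d, φ (Dm t)⁆ = -(size t : ℂ) • φ (Dm t) := by
      conv_lhs => rw [← hd]
      rw [← LieEquiv.map_lie, d_bracket_Dm, map_smul]
    rw [lie_sub, h1, d_bracket_Dm, smul_sub]
  have hbr : ∀ s, size s ≤ n → ⁅φ (Dm t) - Dm t, Dp s⁆ = 0 := by
    intro s hs
    have hts : t ≠ s := fun h => by subst h; omega
    -- As `|s| < |t|`, the bracket only involves `D_r⁻` with `|r| = |t| - |s|`, which `φ` fixes.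
    have h1 : ⁅Dm t, Dp s⁆ = ∑ᶠ r, betaVec t s r • Dm r := by
      have h2 : ⁅Dm t, Dp s⁆ = bracketGen (.minus t) (.plus s) := bracket_basis _ _
      have h3 : ∀ r, alpha t s r = 0 := fun r => by
        by_contra h
        have := size_of_alpha h
        omega
      rw [h2, bracketGen, bracketMinusPlus, if_neg hts]
      simp only [h3, Nat.cast_zero, zero_smul, finsum_zero, zero_add, betaVec_apply]
    rw [sub_lie, sub_eq_zero]
    conv_lhs => rw [← hp s hs]
    rw [← LieEquiv.map_lie, h1, finsum_eq, Finsupp.linearCombination_apply, Finsupp.sum, map_sum]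
    refine Finset.sum_congr rfl fun r hr => ?_
    have h2 := size_of_beta (Nat.cast_ne_zero.1 (Finsupp.mem_support_iff.1 hr))
    have h3 := size_pos s
    rw [map_smul, hm r (by omega)]
  rw [← sub_eq_zero]
  set z := φ (Dm t) - Dm t
  -- `z` has weight `-(n + 1)`, so only the `D_r⁻` with `|r| = n + 1` can occur in it.
  have hw : ∀ r, size r ≠ n + 1 → stdBasis.repr z (.minus r) = 0 := fun r hr =>
    repr_eq_zero_of_weight hz (by
      rw [weight, ht]
      push_cast
      rw [Ne, neg_inj]
      exact_mod_cast hr)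
  have hins : ∀ s q, minusFun z (ins s (Finsupp.single q 1)) = 0 := by
    intro s q
    by_cases hs : size s ≤ n
    · rw [← minusFun_bracket_Dp, hbr s hs]
      simp
    · rw [← Finsupp.sum_single (ins s (Finsupp.single q 1)), Finsupp.sum, map_sum]
      refine Finset.sum_eq_zero fun r hr => ?_
      rw [Finsupp.mem_support_iff, ins_coeff] at hr
      have h1 := size_of_beta (Nat.cast_ne_zero.1 hr)
      have h2 := size_pos q
      rw [← mul_one (ins s _ r), ← smul_eq_mul, ← Finsupp.smul_single, map_smul, minusFun_single,
        hw r (by omega), smul_zero]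
  refine stdBasis.repr.injective (Finsupp.ext fun a => ?_)
  rw [map_zero, Finsupp.zero_apply]
  have h0 : ∀ k : ℕ, (k : ℂ) ≠ -((n + 1 : ℕ) : ℂ) := fun k h => by
    have : k + (n + 1) = 0 := by
      rw [← Nat.cast_eq_zero (R := ℂ), Nat.cast_add, h, neg_add_cancel]
    omega
  cases a with
  | d =>
    refine repr_eq_zero_of_weight hz ?_
    rw [weight, ht]
    exact_mod_cast h0 0
  | plus r =>
    refine repr_eq_zero_of_weight hz ?_
    rw [weight, ht, Int.cast_natCast]
    exact h0 _
  | minus r =>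
    by_cases hr : size r = n + 1
    · rw [← minusFun_single]
      revert hr
      refine ind (p := fun r => size r = n + 1 → minusFun z (Finsupp.single r 1) = 0)
        (fun r hr => ?_) r
      cases r with
      | node k c =>
        cases k with
        | zero =>
          rw [size_mk, card_node, Fin.sum_univ_zero] at hr
          omega
        | succ k => exact eq_zero_of_comp_ins_eq_zero hins k c
    · exact hw r hr

theorem aut_Dp_iff (φ : Aut) (t : TreeClass) :
    φ (Dp t) = Dp t ↔ (tauZeroAut * φ * tauZeroAut) (Dm t) = Dm t := by
  have h1 : (tauZeroAut * φ * tauZeroAut) (Dm t) = tauZeroAut (-((xi t : ℂ)⁻¹ • φ (Dp t))) := by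
    rw [mul_apply, mul_apply, tauZeroAut_apply (Dm t), tauZero_Dm, map_neg, map_smul]
  have h2 : Dm t = tauZeroAut (-((xi t : ℂ)⁻¹ • Dp t)) := by
    rw [← tauZero_Dm, ← tauZeroAut_apply, ← mul_apply, tauZeroAut_mul_self, one_apply]
  rw [h1]
  conv_rhs => rw [h2]
  have h3 : Function.Injective fun x => tauZeroAut x := tauZeroAut.injective
  rw [h3.eq_iff, neg_inj,
    (smul_right_injective InsElim (inv_ne_zero (xi_cast_ne_zero t))).eq_iff]

theorem aut_Dm_iff (φ : Aut) (t : TreeClass) :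
    φ (Dm t) = Dm t ↔ (tauZeroAut * φ * tauZeroAut) (Dp t) = Dp t := by
  rw [aut_Dp_iff]
  have : tauZeroAut * (tauZeroAut * φ * tauZeroAut) * tauZeroAut = φ := by
    rw [mul_assoc, mul_assoc _ tauZeroAut tauZeroAut, tauZeroAut_mul_self, mul_one, ← mul_assoc,
      tauZeroAut_mul_self, one_mul]
  rw [this]

theorem conj_d {φ : Aut} (hd : φ d = d) : (tauZeroAut * φ * tauZeroAut) d = d := by
  rw [mul_apply, mul_apply, tauZeroAut_apply d, tauZero_d, map_neg, hd, map_neg, tauZeroAut_apply,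
    tauZero_d, neg_neg]

/-- An automorphism fixing the elements of degree `0`, `1` and `-1` is the identity. -/
theorem aut_eq_one {φ : Aut} (hd : φ d = d) (hp : φ (Dp (mk dot)) = Dp (mk dot))
    (hm : φ (Dm (mk dot)) = Dm (mk dot)) : φ = 1 := by
  have key : ∀ n, 1 ≤ n → ∀ s, size s ≤ n → φ (Dp s) = Dp s ∧ φ (Dm s) = Dm s := by
    intro n hn
    induction n, hn using Nat.le_induction with
    | base =>
      intro s hs
      obtain rfl := eq_mk_dot_of_size (le_antisymm hs (size_pos s))
      exact ⟨hp, hm⟩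
    | succ n hn ih =>
      intro s hs
      rcases Nat.le_succ_iff.1 hs with hs | hs
      · exact ih s hs
      · refine ⟨(aut_Dp_iff φ s).2 (aut_Dm_of_size_eq_succ (conj_d hd) hn (fun r hr => ?_)
          (fun r hr => ?_) hs),
          aut_Dm_of_size_eq_succ hd hn (fun r hr => (ih r hr).1) (fun r hr => (ih r hr).2) hs⟩
        · exact (aut_Dm_iff φ r).1 (ih r hr).2
        · exact (aut_Dp_iff φ r).1 (ih r hr).1
  exact aut_ext hd (fun t => (key _ (size_pos t) t le_rfl).1)
    (fun t => (key _ (size_pos t) t le_rfl).2)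

theorem weight_eq_one {a : InsElimGen} (h : weight a = 1) : a = .plus (mk dot) := by
  cases a with
  | d => simp [weight] at h
  | plus t => rw [eq_mk_dot_of_size (t := t) (by rw [weight] at h; omega)]
  | minus t => rw [weight] at h; omega

theorem weight_eq_neg_one {a : InsElimGen} (h : weight a = -1) : a = .minus (mk dot) := by
  cases a with
  | d => simp [weight] at h
  | plus t => rw [weight] at h; omega
  | minus t => rw [eq_mk_dot_of_size (t := t) (by rw [weight] at h; omega)]

theorem eq_smul_of_weight {x : InsElim} {k : ℤ} (h : ⁅d, x⁆ = (k : ℂ) • x) {a : InsElimGen}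
    (ha : ∀ b, weight b = k → b = a) : x = stdBasis.repr x a • stdBasis a := by
  classical
  refine stdBasis.repr.injective (Finsupp.ext fun b => ?_)
  rw [map_smul, Module.Basis.repr_self, Finsupp.smul_single, smul_eq_mul, mul_one]
  by_cases hb : b = a
  · rw [hb, Finsupp.single_eq_same]
  · rw [Finsupp.single_eq_of_ne hb]
    exact repr_eq_zero_of_weight h fun h' => hb (ha b (by exact_mod_cast h'))

theorem bracket_Dm_Dp_self (t : TreeClass) : ⁅Dm t, Dp t⁆ = d := by
  have h : ⁅Dm t, Dp t⁆ = bracketGen (.minus t) (.plus t) := bracket_basis _ _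
  rw [h, bracketGen, bracketMinusPlus, if_pos rfl]

/-- The automorphisms fixing `d` are the `τ_ζ`. -/
theorem exists_eq_tauAut {φ : Aut} (hd : φ d = d) : ∃ ζ, φ = tauAut ζ := by
  have hp : ⁅d, φ (Dp (mk dot))⁆ = ((1 : ℤ) : ℂ) • φ (Dp (mk dot)) := by
    conv_lhs => rw [← hd]
    rw [← LieEquiv.map_lie, d_bracket_Dp, map_smul, size_dot, Nat.cast_one, Int.cast_one]
  have hm : ⁅d, φ (Dm (mk dot))⁆ = ((-1 : ℤ) : ℂ) • φ (Dm (mk dot)) := by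
    conv_lhs => rw [← hd]
    rw [← LieEquiv.map_lie, d_bracket_Dm, map_smul, size_dot, Nat.cast_one, Int.cast_neg,
      Int.cast_one]
  obtain ⟨a, ha⟩ : ∃ a : ℂ, φ (Dp (mk dot)) = a • Dp (mk dot) :=
    ⟨_, eq_smul_of_weight hp fun _ => weight_eq_one⟩
  obtain ⟨b, hb⟩ : ∃ b : ℂ, φ (Dm (mk dot)) = b • Dm (mk dot) :=
    ⟨_, eq_smul_of_weight hm fun _ => weight_eq_neg_one⟩
  have hba : b * a = 1 := by
    have h1 : φ ⁅Dm (mk dot), Dp (mk dot)⁆ = (b * a) • d := by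
      rw [LieEquiv.map_lie, ha, hb, smul_lie, lie_smul, bracket_Dm_Dp_self, smul_smul]
    rw [bracket_Dm_Dp_self, hd] at h1
    have h2 := DFunLike.congr_fun (congrArg stdBasis.repr h1) .d
    rw [map_smul, repr_d, Finsupp.smul_apply, Finsupp.single_eq_same, smul_eq_mul, mul_one] at h2
    exact h2.symm
  refine ⟨⟨a, b, by rw [mul_comm, hba], hba⟩, ?_⟩
  set ζ : ℂˣ := ⟨a, b, by rw [mul_comm, hba], hba⟩ with hζ
  have h1 : tauAut ζ⁻¹ * φ = 1 := by
    refine aut_eq_one ?_ ?_ ?_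
    · rw [mul_apply, hd, tauAut_apply, tau_d]
    · rw [mul_apply, ha, map_smul, tauAut_apply, tau_Dp, size_dot, smul_smul]
      simp [hζ, mul_comm a, hba]
    · rw [mul_apply, hb, map_smul, tauAut_apply, tau_Dm, size_dot, smul_smul]
      simp [hζ, mul_inv_cancel₀ (left_ne_zero_of_mul_eq_one hba)]
  rw [← one_mul φ, ← tauAut_one, ← mul_inv_cancel ζ, ← tauAut_mul, mul_assoc, h1, mul_one]

end InsElim

/-! ### The automorphism group -/

open InsElim

theorem mainTheorem1 :
    ∃ (τ : ℂˣ → InsElim.Aut) (τ₀ : InsElim.Aut) (A A₀ : Subgroup InsElim.Aut),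
      (∀ ζ x, τ ζ x = InsElim.tau ζ x) ∧
      (∀ x, τ₀ x = InsElim.tauZero x) ∧
      (A : Set InsElim.Aut) = {φ | ∃ ζ : ℂˣ, φ = τ ζ} ∧
      (A₀ : Set InsElim.Aut) = {1, τ₀} ∧
      A.Normal ∧
      A.IsComplement' A₀ ∧
      ∀ ζ : ℂˣ, τ₀ * τ ζ * τ₀ = τ ζ⁻¹ := by
  have hinv : tauZeroAut⁻¹ = tauZeroAut := inv_eq_of_mul_eq_one_left tauZeroAut_mul_self
  have hd0 : (d : InsElim) ≠ -d := fun h => by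
    have h1 := DFunLike.congr_fun (congrArg stdBasis.repr h) .d
    rw [map_neg, repr_d, Finsupp.neg_apply, Finsupp.single_eq_same] at h1
    norm_num at h1
  have hfix : ∀ ζ, tauAut ζ d = d := fun ζ => tau_d ζ
  have hz : tauZeroAut d = -d := tauZero_d
  let A : Subgroup Aut :=
    { carrier := {φ | ∃ ζ : ℂˣ, φ = tauAut ζ}
      mul_mem' := by
        rintro _ _ ⟨ζ, rfl⟩ ⟨η, rfl⟩
        exact ⟨ζ * η, tauAut_mul ζ η⟩
      one_mem' := ⟨1, tauAut_one.symm⟩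
      inv_mem' := by
        rintro _ ⟨ζ, rfl⟩
        exact ⟨ζ⁻¹, inv_eq_of_mul_eq_one_left (by rw [tauAut_mul, inv_mul_cancel, tauAut_one])⟩ }
  let A₀ : Subgroup Aut :=
    { carrier := {1, tauZeroAut}
      mul_mem' := by
        rintro _ _ (rfl | rfl) (rfl | rfl)
        · exact Or.inl (mul_one _)
        · exact Or.inr (one_mul _)
        · exact Or.inr (mul_one _)
        · exact Or.inl tauZeroAut_mul_self
      one_mem' := Or.inl rfl
      inv_mem' := by
        rintro _ (rfl | rfl)
        · exact Or.inl inv_one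
        · exact Or.inr hinv }
  -- `A` is the stabilizer of `d`, hence normal, as every automorphism maps `d` to `±d`.
  have hA : ∀ φ : Aut, φ ∈ A ↔ φ d = d := fun φ =>
    ⟨fun ⟨ζ, h⟩ => by rw [h, hfix], exists_eq_tauAut⟩
  refine ⟨tauAut, tauZeroAut, A, A₀, fun _ _ => rfl, fun _ => rfl, rfl, rfl, ⟨fun φ hφ ψ => ?_⟩,
    ?_, tauZeroAut_conj⟩
  · rw [hA] at hφ ⊢
    rw [mul_apply, mul_apply]
    rcases aut_d ψ⁻¹ with h | h
    · rw [h, hφ, ← h, apply_inv_self, h]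
    · rw [h, map_neg, hφ, ← h, apply_inv_self]
  · refine Subgroup.isComplement'_of_disjoint_and_mul_eq_univ ?_ ?_
    · rw [Subgroup.disjoint_def]
      rintro φ hφ (h | h)
      · exact h
      · rw [Set.mem_singleton_iff] at h
        rw [hA, h, hz] at hφ
        exact absurd hφ.symm hd0
    · refine Set.eq_univ_of_forall fun φ => ?_
      rcases aut_d φ with h | h
      · exact Set.mem_mul.2 ⟨φ, (hA φ).2 h, 1, Or.inl rfl, mul_one φ⟩
      · refine Set.mem_mul.2 ⟨φ * tauZeroAut, (hA _).2 ?_, tauZeroAut, Or.inr rfl, ?_⟩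
        · rw [mul_apply, hz, map_neg, h, neg_neg]
        · rw [mul_assoc, tauZeroAut_mul_self, mul_one]
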